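/- For a superpoint $B=\mathbb{R}^{0|s}$ ($s\ge 0$) let $\mathcal{O}_B=\bigwedge\mathbb{R}^s$ be its Grassmann algebra of functions, and let $(\mathcal{O}_B\otimes\mathbb{C})_0$, $(\mathcal{O}_B\otimes\mathbb{C})_1$ be the even and odd parts of its complexification. Complex supermanifolds are described by their functors of points on superpoints; maps between them are superholomorphic if they are natural in $B$ and, locally on $B$-points, holomorphic with $(\mathcal{O}_B\otimes\mathbb{C})_0$-linear differential. Let $\mathrm{SpO}_{\mathbb{C}}(2|1)$ be the group whose $B$-points are the invertible even supermatrices $$L=\begin{pmatrix} a & c & \gamma\\ b & d & \delta\\ \alpha & \beta & e\end{pmatrix},\qquad a,b,c,d,e\in(\mathcal{O}_B\otimes\mathbb{C})_0,\quad \alpha,\beta,\gamma,\delta\in(\mathcal{O}_B\otimes\mathbb{C})_1,$$ with $ad-bc-\gamma\delta=1$, $e^2+2\alpha\beta=1$, $c\alpha-a\beta=e\gamma$ and $d\alpha-b\beta=e\delta$. The group $\mathrm{SC}(\mathbb{P}^{1|1}_{\mathbb{C}})$ of superconformal automorphisms of $\mathbb{P}^{1|1}_{\mathbb{C}}$ is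 realised as the connected component of $\mathrm{SpO}_{\mathbb{C}}(2|1)$ on which the reduction of $e$ (modulo nilpotents) is $1$. The $B$-points of $\mathrm{SL}_{\mathbb{C}}(2)$ are the $2\times 2$ matrices over $(\mathcal{O}_B\otimes\mathbb{C})_0$ of determinant $1$, and the $B$-points of $\mathbb{C}^{0|2}$ are the pairs $(\alpha,\beta)$ of elements of $(\mathcal{O}_B\otimes\mathbb{C})_1$. Put $$S(\alpha,\beta)=\begin{pmatrix} 1+\tfrac12\alpha\beta & 0 & -\beta\\ 0 & 1+\tfrac12\alpha\beta & \alpha\\ \alpha & \beta & 1-\alpha\beta\end{pmatrix}.$$ Then $\mathrm{SL}_{\mathbb{C}}(2)$ and $\mathrm{SC}(\mathbb{P}^{1|1}_{\mathbb{C}})$ are complex super Lie groups of dimensions $3|0$ and $3|2$, and the following hold. 1. The homomorphism $\iota\colon \mathrm{SL}_{\mathbb{C}}(2)\to\mathrm{SC}(\mathbb{P}^{1|1}_{\mathbb{C}})$, $\begin{pmatrix} a&c\\ b&d\end{pmatrix}\mapsto\begin{pmatrix} a&c&0\\ b&d&0\\ 0&0&1\end{pmatrix}$, is an embedding of complex super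 Lie groups. 2. The space of cosets $\mathrm{SL}_{\mathbb{C}}(2)\backslash\mathrm{SC}(\mathbb{P}^{1|1}_{\mathbb{C}})$ (the quotient by left multiplication) exists and is isomorphic to $\mathbb{C}^{0|2}$, the isomorphism sending the coset of $S(\alpha,\beta)$ to $(\alpha,\beta)$. That is, there are bijections $\Psi_B\colon \mathrm{SL}_{\mathbb{C}}(2)(B)\backslash\mathrm{SC}(\mathbb{P}^{1|1}_{\mathbb{C}})(B)\to\mathbb{C}^{0|2}(B)$ with $\Psi_B([S(\alpha,\beta)])=(\alpha,\beta)$ such that $L\mapsto\Psi_B([L])$ is a superholomorphic surjective submersion $\mathrm{SC}(\mathbb{P}^{1|1}_{\mathbb{C}})\to\mathbb{C}^{0|2}$ through which every $\mathrm{SL}_{\mathbb{C}}(2)$-invariant superholomorphic map from $\mathrm{SC}(\mathbb{P}^{1|1}_{\mathbb{C}})$ to a subspace of a finite-dimensional complex linear superspace factors uniquely and superholomorphically. 3. The map $(l,(\alpha,\beta))\mapsto\iota(l)\,S(\alpha,\beta)$ is an isomorphism of complex supermanifolds $\mathrm{SL}_{\mathbb{C}}(2)\times\mathbb{C}^{0|2}\to\mathrm{SC}(\mathbb{P}^{1|1}_{\mathbb{C}})$.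 In particular, for every $B$, every element of $\mathrm{SC}(\mathbb{P}^{1|1}_{\mathbb{C}})(B)$ is in a unique way the product of an element of $\mathrm{SL}_{\mathbb{C}}(2)(B)$ and a supersymmetry transformation $S(\alpha,\beta)$. -/

import Mathlib

open scoped TensorProduct

noncomputable section

namespace SG

/-! ### Superpoints and their complexified function algebras -/

/-- The real Grassmann algebra on `s` generators: the functions on the superpoint `ℝ^{0|s}`. -/
abbrev Gras (s : ℕ) : Type := ExteriorAlgebra ℝ (Fin s → ℝ)

/-- The grade involution of the real Grassmann algebra (each generator is sent to its negative). -/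
def grasInvol (s : ℕ) : Gras s →ₐ[ℝ] Gras s := CliffordAlgebra.involute

/-- A morphism of superpoints `ℝ^{0|t} → ℝ^{0|s}`: an algebra homomorphism of the Grassmann
algebras in the opposite direction that preserves parity. -/
structure SPHom (s t : ℕ) where
  hom : Gras s →ₐ[ℝ] Gras t
  parity : ∀ x, hom (grasInvol s x) = grasInvol t (hom x)

/-- The complexified algebra `𝒪_B ⊗ ℂ` of functions on the superpoint `B = ℝ^{0|s}`. -/
def OB (s : ℕ) : Type := ℂ ⊗[ℝ] Gras s

instance (s : ℕ) : Ring (OB s) := inferInstanceAs (Ring (ℂ ⊗[ℝ] Gras s))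
instance (s : ℕ) : Algebra ℂ (OB s) := inferInstanceAs (Algebra ℂ (ℂ ⊗[ℝ] Gras s))

/-- The expansion of an element of `𝒪_B ⊗ ℂ` in the monomials in the generators. -/
def obBasis (s : ℕ) : Module.Basis (Finset (Fin s)) ℂ (OB s) :=
  (Pi.basisFun ℝ (Fin s)).ExteriorAlgebra.baseChange ℂ

/-- `𝒪_B ⊗ ℂ` is a finite-dimensional complex vector space; we norm it by the maximum of the
absolute values of the coefficients (all norms on it are equivalent). -/
instance (s : ℕ) : NormedAddCommGroup (OB s) :=
  NormedAddCommGroup.induced (OB s) (Finset (Fin s) → ℂ) (obBasis s).equivFun.toLinearMap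
    (obBasis s).equivFun.injective

instance (s : ℕ) : NormedSpace ℂ (OB s) :=
  NormedSpace.induced ℂ (OB s) (Finset (Fin s) → ℂ) (obBasis s).equivFun.toLinearMap

instance (s : ℕ) : FiniteDimensional ℂ (OB s) := Module.Finite.of_basis (obBasis s)

/-- The grade involution of `𝒪_B ⊗ ℂ`. -/
def invol (s : ℕ) : OB s →ₐ[ℂ] OB s :=
  Algebra.TensorProduct.map (AlgHom.id ℂ ℂ) (grasInvol s)

/-- The body (reduction) homomorphism `𝒪_B ⊗ ℂ → ℂ`, killing all generators. -/
def body (s : ℕ) : OB s →ₐ[ℂ] ℂ :=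
  Algebra.TensorProduct.lift (AlgHom.id ℂ ℂ)
    ((Algebra.ofId ℝ ℂ).comp (ExteriorAlgebra.algebraMapInv (M := Fin s → ℝ)))
    (fun _ _ => Commute.all _ _)

/-- The pullback of complexified functions along a morphism of superpoints. -/
def SPHom.ob {s t : ℕ} (φ : SPHom s t) : OB s →ₐ[ℂ] OB t :=
  Algebra.TensorProduct.map (AlgHom.id ℂ ℂ) φ.hom

/-- The sign of a parity. -/
def sgn (k : ZMod 2) : ℂ := if k = 0 then 1 else -1

/-- The part of parity `k` of `𝒪_B ⊗ ℂ`: elements on which the grade involution acts by the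
sign of `k`. So `gr s 0` is the even part and `gr s 1` the odd part. -/
def gr (s : ℕ) (k : ZMod 2) : Submodule ℂ (OB s) where
  carrier := {x | invol s x = sgn k • x}
  add_mem' := by
    intro x y hx hy
    simp only [Set.mem_ofPred_eq] at *
    rw [map_add, hx, hy, smul_add]
  zero_mem' := by simp
  smul_mem' := by
    intro c x hx
    simp only [Set.mem_ofPred_eq] at *
    rw [map_smul, hx, smul_comm]

theorem mem_gr {s : ℕ} {k : ZMod 2} {x : OB s} : x ∈ gr s k ↔ invol s x = sgn k • x := Iff.rfl

theorem sgn_add (k l : ZMod 2) : sgn (k + l) = sgn k * sgn l := by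
  revert k l
  have h : ∀ k : ZMod 2, k = 0 ∨ k = 1 := by decide
  intro k l
  have h2 : (1 : ZMod 2) + 1 = 0 := by decide
  rcases h k with rfl | rfl <;> rcases h l with rfl | rfl <;> simp [sgn, h2]

theorem mul_mem_gr {s : ℕ} {k l : ZMod 2} {x y : OB s} (hx : x ∈ gr s k) (hy : y ∈ gr s l) :
    x * y ∈ gr s (k + l) := by
  rw [mem_gr] at *
  rw [map_mul, hx, hy, sgn_add, smul_mul_smul_comm]

theorem one_mem_gr (s : ℕ) : (1 : OB s) ∈ gr s 0 := by
  rw [mem_gr]; simp [sgn]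

theorem invol_even {s : ℕ} {x : OB s} (hx : x ∈ gr s 0) : invol s x = x := by
  rw [mem_gr] at hx; simpa [sgn] using hx

theorem invol_odd {s : ℕ} {x : OB s} (hx : x ∈ gr s 1) : invol s x = -x := by
  rw [mem_gr] at hx; simpa [sgn] using hx

theorem ob_invol {s t : ℕ} (φ : SPHom s t) (x : OB s) :
    φ.ob (invol s x) = invol t (φ.ob x) := by
  have h : (φ.ob.comp (invol s)) = ((invol t).comp φ.ob) := by
    apply Algebra.TensorProduct.ext'
    intro a b
    change a ⊗ₜ[ℝ] φ.hom (grasInvol s b) = a ⊗ₜ[ℝ] grasInvol t (φ.hom b)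
    rw [φ.parity]
  exact DFunLike.congr_fun h x

theorem ob_mem_gr {s t : ℕ} (φ : SPHom s t) {k : ZMod 2} {x : OB s} (hx : x ∈ gr s k) :
    φ.ob x ∈ gr t k := by
  rw [mem_gr] at *
  rw [← ob_invol, hx, map_smul]

/-! ### Graded commutativity -/

/-- A generator of the Grassmann algebra, as an element of `𝒪_B ⊗ ℂ`. -/
def gen {s : ℕ} (x : Gras s) : OB s := (1 : ℂ) ⊗ₜ[ℝ] x

theorem gras_gen_mul {s : ℕ} (v : Fin s → ℝ) (w : Gras s) :
    ExteriorAlgebra.ι ℝ v * w = grasInvol s w * ExteriorAlgebra.ι ℝ v := by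
  induction w using ExteriorAlgebra.induction with
  | algebraMap r => simp [Algebra.commutes]
  | ι u =>
    have h := ExteriorAlgebra.ι_add_mul_swap (R := ℝ) v u
    have h2 : grasInvol s (ExteriorAlgebra.ι ℝ u) = - ExteriorAlgebra.ι ℝ u :=
      CliffordAlgebra.involute_ι u
    rw [h2, neg_mul]
    exact eq_neg_of_add_eq_zero_left h
  | mul a b ha hb => rw [← mul_assoc, ha, mul_assoc, hb, map_mul, mul_assoc]
  | add a b ha hb => rw [mul_add, ha, hb, map_add, add_mul]

theorem tmul_eq {s : ℕ} (z : ℂ) (w : Gras s) : ((z ⊗ₜ[ℝ] w : ℂ ⊗[ℝ] Gras s) : OB s) = z • gen w := by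
  change z ⊗ₜ[ℝ] w = z • ((1 : ℂ) ⊗ₜ[ℝ] w)
  rw [TensorProduct.smul_tmul', smul_eq_mul, mul_one]

theorem OB.induction {s : ℕ} {P : OB s → Prop} (zero : P 0) (tmul : ∀ (z : ℂ) w, P (z • gen w))
    (add : ∀ a b, P a → P b → P (a + b)) (x : OB s) : P x :=
  TensorProduct.induction_on (motive := P) x zero
    (fun z w => by rw [tmul_eq]; exact tmul z w) add

theorem gen_mul' {s : ℕ} (a b : Gras s) : gen (a * b) = gen a * gen b := by
  have h := Algebra.TensorProduct.tmul_mul_tmul (R := ℝ) (1 : ℂ) 1 a b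
  rw [one_mul] at h
  exact h.symm

theorem gen_add {s : ℕ} (a b : Gras s) : gen (a + b) = gen a + gen b :=
  TensorProduct.tmul_add _ _ _

theorem gen_algebraMap {s : ℕ} (r : ℝ) :
    (gen (algebraMap ℝ (Gras s) r) : OB s) = algebraMap ℂ (OB s) r := by
  change (1 : ℂ) ⊗ₜ[ℝ] (algebraMap ℝ (Gras s) r) = (r : ℂ) ⊗ₜ[ℝ] (1 : Gras s)
  rw [Algebra.algebraMap_eq_smul_one, ← TensorProduct.smul_tmul]
  simp

theorem invol_gen {s : ℕ} (w : Gras s) : invol s (gen w) = gen (grasInvol s w) := rfl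

theorem gen_mul {s : ℕ} (v : Fin s → ℝ) (y : OB s) :
    gen (ExteriorAlgebra.ι ℝ v) * y = invol s y * gen (ExteriorAlgebra.ι ℝ v) := by
  induction y using OB.induction with
  | zero => rw [mul_zero, map_zero, zero_mul]
  | tmul z w =>
    rw [map_smul, invol_gen, mul_smul_comm, smul_mul_assoc, ← gen_mul', ← gen_mul', gras_gen_mul]
  | add a b ha hb => rw [mul_add, map_add, add_mul, ha, hb]

/-- Even elements are central. -/
theorem even_comm {s : ℕ} {y : OB s} (hy : y ∈ gr s 0) (x : OB s) : x * y = y * x := by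
  have hg : ∀ w : Gras s, gen w * y = y * gen w := by
    intro w
    induction w using ExteriorAlgebra.induction with
    | algebraMap r => rw [gen_algebraMap]; exact Algebra.commutes _ _
    | ι v => rw [gen_mul, invol_even hy]
    | mul a b ha hb => rw [gen_mul', mul_assoc, hb, ← mul_assoc, ha, mul_assoc]
    | add a b ha hb => rw [gen_add, add_mul, mul_add, ha, hb]
  induction x using OB.induction with
  | zero => rw [mul_zero, zero_mul]
  | tmul z w => rw [smul_mul_assoc, hg, mul_smul_comm]
  | add a b ha hb => rw [mul_add, add_mul, ha, hb]

/-- Odd elements anticommute. -/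
theorem odd_comm {s : ℕ} {x y : OB s} (hx : x ∈ gr s 1) (hy : y ∈ gr s 1) :
    x * y = -(y * x) := by
  have hg : ∀ w : Gras s, gen w * y = y * invol s (gen w) := by
    intro w
    induction w using ExteriorAlgebra.induction with
    | algebraMap r => rw [gen_algebraMap, AlgHom.commutes]; exact Algebra.commutes _ _
    | ι v =>
      have h2 : grasInvol s (ExteriorAlgebra.ι ℝ v) = - ExteriorAlgebra.ι ℝ v :=
        CliffordAlgebra.involute_ι v
      have h3 : (gen (- ExteriorAlgebra.ι ℝ v : Gras s) : OB s) = - gen (ExteriorAlgebra.ι ℝ v) :=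
        TensorProduct.tmul_neg _ _
      rw [gen_mul, invol_odd hy, invol_gen, h2, h3, mul_neg, neg_mul]
    | mul a b ha hb => rw [gen_mul', mul_assoc, hb, ← mul_assoc, ha, map_mul, mul_assoc]
    | add a b ha hb => rw [gen_add, add_mul, map_add, mul_add, ha, hb]
  have key : ∀ x : OB s, x * y = y * invol s x := by
    intro x
    induction x using OB.induction with
    | zero => rw [map_zero, mul_zero, zero_mul]
    | tmul z w => rw [smul_mul_assoc, hg, map_smul, mul_smul_comm]
    | add a b ha hb => rw [map_add, mul_add, add_mul, ha, hb]
  rw [key, invol_odd hx, mul_neg]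

/-- The commutative algebra `(𝒪_B ⊗ ℂ)₀` of even functions. -/
def Even (s : ℕ) : Subalgebra ℂ (OB s) where
  carrier := gr s 0
  mul_mem' := by
    intro a b ha hb
    have := mul_mem_gr ha hb
    rwa [add_zero] at this
  add_mem' := (gr s 0).add_mem
  algebraMap_mem' := by
    intro r
    rw [Algebra.algebraMap_eq_smul_one]
    exact (gr s 0).smul_mem r (one_mem_gr s)

instance (s : ℕ) : CommRing (Even s) :=
  { (inferInstance : Ring (Even s)) with
    mul_comm := fun a b => Subtype.ext (even_comm b.2 a.1) }

/-- The pullback of even functions along a morphism of superpoints. -/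
def SPHom.even {s t : ℕ} (φ : SPHom s t) : Even s →+* Even t :=
  (φ.ob : OB s →+* OB t).restrict (Even s) (Even t) (fun _ hx => ob_mem_gr φ hx)

/-! ### Complex superdomains and superholomorphic maps -/

/-- The `ℝ^{0|s}`-points of the complex linear superspace whose coordinates are indexed by `ι`,
the coordinate `i` having parity `p i`. -/
abbrev SVec {ι : Type} (p : ι → ZMod 2) (s : ℕ) : Type := ∀ i, gr s (p i)

/-- Functoriality of the points of a linear superspace. -/
def SVec.map {ι : Type} {p : ι → ZMod 2} {s t : ℕ} (φ : SPHom s t) (x : SVec p s) : SVec p t :=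
  fun i => ⟨φ.ob (x i), ob_mem_gr φ (x i).2⟩

/-- The reduced point underlying a point of a linear superspace (its odd coordinates are `0`). -/
def SVec.red {ι : Type} {p : ι → ZMod 2} {s : ℕ} (x : SVec p s) : ι → ℂ :=
  fun i => body s (x i)

/-- The action of even functions on the points of a linear superspace. -/
def SVec.evenSMul {ι : Type} {p : ι → ZMod 2} {s : ℕ} (l : Even s) (x : SVec p s) : SVec p s :=
  fun i => ⟨(l : OB s) * x i, by
    have := mul_mem_gr (k := 0) l.2 (x i).2
    rwa [zero_add] at this⟩

/-- The `ℝ^{0|s}`-points of the open superdomain with underlying open set `U`. -/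
def dom {ι : Type} (p : ι → ZMod 2) (U : Set (ι → ℂ)) (s : ℕ) : Set (SVec p s) :=
  {x | x.red ∈ U}

/-- `f` is a superholomorphic map from the superdomain over `U` to a linear superspace: it is
natural in the superpoint, on the points over each superpoint it is holomorphic, and its
differentials are linear over the even functions. -/
structure SHolOn {ι κ : Type} [Fintype ι] [Fintype κ] {p : ι → ZMod 2} {q : κ → ZMod 2}
    (U : Set (ι → ℂ)) (f : ∀ s, SVec p s → SVec q s) : Prop where
  natural : ∀ (s t : ℕ) (φ : SPHom s t), ∀ x ∈ dom p U s, f t (x.map φ) = (f s x).map φ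
  holo : ∀ s, DifferentiableOn ℂ (f s) (dom p U s)
  evenLinear : ∀ s, ∀ x ∈ dom p U s, ∀ (l : Even s) (v : SVec p s),
    fderiv ℂ (f s) x (v.evenSMul l) = (fderiv ℂ (f s) x v).evenSMul l

/-! ### Supermanifolds inside linear superspaces -/

/-- A functor of points on superpoints that is realised as a subfunctor of a finite-dimensional
complex linear superspace. -/
structure SSpace where
  /-- index set of the ambient coordinates -/
  ι : Type
  fin : Fintype ι
  /-- parities of the ambient coordinates -/
  par : ι → ZMod 2
  /-- the `ℝ^{0|s}`-points -/
  pts : ℕ → Type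
  map : ∀ {s t : ℕ}, SPHom s t → pts s → pts t
  coord : ∀ {s : ℕ}, pts s → SVec par s
  coord_injective : ∀ s, Function.Injective (coord (s := s))
  coord_map : ∀ {s t : ℕ} (φ : SPHom s t) (x : pts s), coord (map φ x) = (coord x).map φ

attribute [instance] SSpace.fin

/-- `X` is a complex supermanifold of dimension `m|n`, as a sub-supermanifold of its ambient
linear superspace: near each point it is the zero locus of a superholomorphic map, submersive
along `X`, to a linear superspace of the complementary dimension. -/
def IsSupermanifold (X : SSpace) (m n : ℕ) : Prop :=
  ∀ (s₀ : ℕ) (x₀ : X.pts s₀), ∃ U : Set (X.ι → ℂ), IsOpen U ∧ (X.coord x₀).red ∈ U ∧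
    ∃ (k : ℕ) (q : Fin k → ZMod 2) (F : ∀ s, SVec X.par s → SVec q s),
      SHolOn U F ∧
      (∀ s, ∀ y ∈ dom X.par U s, (∃ x : X.pts s, X.coord x = y) ↔ F s y = 0) ∧
      (∀ (s : ℕ) (x : X.pts s), X.coord x ∈ dom X.par U s →
        Function.Surjective (fderiv ℂ (F s) (X.coord x))) ∧
      m + Nat.card {j // q j = 0} = Nat.card {i // X.par i = 0} ∧
      n + Nat.card {j // q j = 1} = Nat.card {i // X.par i = 1}

/-- A map of points is superholomorphic if it is natural and locally the restriction of a
superholomorphic map between superdomains of the ambient linear superspaces. -/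
def IsSHol (X Y : SSpace) (f : ∀ s, X.pts s → Y.pts s) : Prop :=
  (∀ (s t : ℕ) (φ : SPHom s t) (x : X.pts s), f t (X.map φ x) = Y.map φ (f s x)) ∧
  ∀ (s₀ : ℕ) (x₀ : X.pts s₀), ∃ U : Set (X.ι → ℂ), IsOpen U ∧ (X.coord x₀).red ∈ U ∧
    ∃ g : ∀ s, SVec X.par s → SVec Y.par s, SHolOn U g ∧
      ∀ (s : ℕ) (x : X.pts s), X.coord x ∈ dom X.par U s → Y.coord (f s x) = g s (X.coord x)

/-- An isomorphism: a superholomorphic map with a superholomorphic inverse. -/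
def IsSIso (X Y : SSpace) (f : ∀ s, X.pts s → Y.pts s) : Prop :=
  IsSHol X Y f ∧ ∃ g : ∀ s, Y.pts s → X.pts s, IsSHol Y X g ∧
    (∀ s x, g s (f s x) = x) ∧ (∀ s y, f s (g s y) = y)

/-- An embedding: an injective superholomorphic map whose inverse, defined on the image, is
superholomorphic, that is, locally the restriction of a superholomorphic map. -/
def IsSEmbedding (X Y : SSpace) (f : ∀ s, X.pts s → Y.pts s) : Prop :=
  IsSHol X Y f ∧ (∀ s, Function.Injective (f s)) ∧
  ∀ (s₀ : ℕ) (x₀ : X.pts s₀), ∃ U : Set (Y.ι → ℂ), IsOpen U ∧ (Y.coord (f s₀ x₀)).red ∈ U ∧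
    ∃ g : ∀ s, SVec Y.par s → SVec X.par s, SHolOn U g ∧
      ∀ (s : ℕ) (x : X.pts s), Y.coord (f s x) ∈ dom Y.par U s →
        X.coord x = g s (Y.coord (f s x))

/-- The linear superspace with coordinates of parities `p`. -/
def linSpace {ι : Type} [h : Fintype ι] (p : ι → ZMod 2) : SSpace where
  ι := ι
  fin := h
  par := p
  pts := SVec p
  map := SVec.map
  coord := id
  coord_injective _ := Function.injective_id
  coord_map _ _ := rfl

/-- The product of two spaces. -/
def prodSpace (X Y : SSpace) : SSpace where
  ι := X.ι ⊕ Y.ι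
  fin := inferInstance
  par := Sum.elim X.par Y.par
  pts s := X.pts s × Y.pts s
  map φ x := (X.map φ x.1, Y.map φ x.2)
  coord x := fun i => match i with
    | Sum.inl i => X.coord x.1 i
    | Sum.inr j => Y.coord x.2 j
  coord_injective s := by
    rintro ⟨a, b⟩ ⟨c, d⟩ h
    have h1 : X.coord a = X.coord c := funext fun i => congrFun h (Sum.inl i)
    have h2 : Y.coord b = Y.coord d := funext fun j => congrFun h (Sum.inr j)
    rw [X.coord_injective s h1, Y.coord_injective s h2]
  coord_map φ x := by
    funext i
    rcases i with i | j
    · exact congrFun (X.coord_map φ x.1) i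
    · exact congrFun (Y.coord_map φ x.2) j

/-- A complex super Lie group of dimension `m|n`: a complex supermanifold whose points form
groups such that multiplication and inversion are superholomorphic (in particular natural). -/
structure IsSuperLieGroup (X : SSpace) [∀ s, Group (X.pts s)] (m n : ℕ) : Prop where
  manifold : IsSupermanifold X m n
  mul : IsSHol (prodSpace X X) X (fun _ x => x.1 * x.2)
  inv : IsSHol X X (fun _ x => x⁻¹)

/-- `π : X → Q` is the quotient of `X` by the action `act` of `G`: it is a surjective submersion
(it has superholomorphic local sections through every reduced point), its fibres on the points
over every superpoint are exactly the orbits, and invariant superholomorphic maps factor uniquely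
and superholomorphically through it. -/
structure IsSQuotient (G X Q : SSpace) (act : ∀ s, G.pts s → X.pts s → X.pts s)
    (π : ∀ s, X.pts s → Q.pts s) : Prop where
  shol : IsSHol X Q π
  surjective : ∀ s, Function.Surjective (π s)
  orbits : ∀ s (x y : X.pts s), π s x = π s y ↔ ∃ g : G.pts s, act s g x = y
  submersion : ∀ x₀ : X.pts 0, ∃ U : Set (Q.ι → ℂ), IsOpen U ∧ (Q.coord (π 0 x₀)).red ∈ U ∧
    ∃ σ : ∀ s, SVec Q.par s → SVec X.par s, SHolOn U σ ∧
      σ 0 (Q.coord (π 0 x₀)) = X.coord x₀ ∧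
      ∀ (s : ℕ) (y : Q.pts s), Q.coord y ∈ dom Q.par U s →
        ∃ x : X.pts s, X.coord x = σ s (Q.coord y) ∧ π s x = y
  universal : ∀ (Y : SSpace) (h : ∀ s, X.pts s → Y.pts s), IsSHol X Y h →
    (∀ s (g : G.pts s) (x : X.pts s), h s (act s g x) = h s x) →
    ∃! h' : ∀ s, Q.pts s → Y.pts s, IsSHol Q Y h' ∧ ∀ s x, h' s (π s x) = h s x

/-! ### The groups `GL_ℂ(2|1)`, `SpO_ℂ(2|1)` and `SC(ℙ^{1|1})` -/

/-- Parities of the rows and columns of a `2|1 × 2|1` supermatrix. -/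
def par3 : Fin 3 → ZMod 2 := ![0, 0, 1]

/-- Parities of the entries of an even `2|1 × 2|1` supermatrix. -/
def matPar (ij : Fin 3 × Fin 3) : ZMod 2 := par3 ij.1 + par3 ij.2

/-- The ring of even `2|1 × 2|1` supermatrices with entries in `𝒪_B ⊗ ℂ`: the upper left
`2 × 2` block and the lower right entry are even, the remaining entries are odd. -/
def SMat (s : ℕ) : Subring (Matrix (Fin 3) (Fin 3) (OB s)) where
  carrier := {M | ∀ i j, M i j ∈ gr s (par3 i + par3 j)}
  mul_mem' := by
    intro M N hM hN i j
    rw [Matrix.mul_apply]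
    refine Submodule.sum_mem _ fun k _ => ?_
    have := mul_mem_gr (hM i k) (hN k j)
    have e : par3 i + par3 k + (par3 k + par3 j) = par3 i + par3 j := by
      generalize par3 i = a
      generalize par3 k = b
      generalize par3 j = c
      revert a b c
      decide
    rwa [e] at this
  one_mem' := by
    intro i j
    rw [Matrix.one_apply]
    split_ifs with h
    · subst h
      have e : par3 i + par3 i = 0 := by
        generalize par3 i = a
        revert a
        decide
      rw [e]
      exact one_mem_gr s
    · exact Submodule.zero_mem _
  add_mem' := fun hM hN i j => Submodule.add_mem _ (hM i j) (hN i j)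
  zero_mem' := fun i j => Submodule.zero_mem _
  neg_mem' := fun hM i j => Submodule.neg_mem _ (hM i j)

/-- The points of `GL_ℂ(2|1)`: invertible even supermatrices. -/
abbrev GL21 (s : ℕ) : Type := (SMat s)ˣ

/-- The matrix entries of a point of `GL_ℂ(2|1)`. -/
def ent {s : ℕ} (L : SMat s) : Matrix (Fin 3) (Fin 3) (OB s) := L.1

/-- The equations of `SpO_ℂ(2|1)` for the supermatrix with rows `(a, c, γ)`, `(b, d, δ)` and
`(α, β, e)`. -/
structure SpEqs {s : ℕ} (M : Matrix (Fin 3) (Fin 3) (OB s)) : Prop where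
  /-- `a d - b c - γ δ = 1` -/
  h1 : M 0 0 * M 1 1 - M 1 0 * M 0 1 - M 0 2 * M 1 2 = 1
  /-- `e² + 2 α β = 1` -/
  h2 : M 2 2 ^ 2 + 2 * (M 2 0 * M 2 1) = 1
  /-- `c α - a β = e γ` -/
  h3 : M 0 1 * M 2 0 - M 0 0 * M 2 1 = M 2 2 * M 0 2
  /-- `d α - b β = e δ` -/
  h4 : M 1 1 * M 2 0 - M 1 0 * M 2 1 = M 2 2 * M 1 2

theorem gr_two {s : ℕ} {x : OB s} (hx : x ∈ gr s ((1 : ZMod 2) + 1)) : x ∈ gr s 0 := by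
  have h : (1 : ZMod 2) + 1 = 0 := by decide
  rwa [h] at hx

theorem odd_sq {s : ℕ} {x : OB s} (hx : x ∈ gr s 1) : x * x = 0 := by
  have h := odd_comm hx hx
  have h2 : (2 : ℂ) • (x * x) = 0 := by
    rw [two_smul]
    nth_rewrite 1 [h]
    exact neg_add_cancel _
  exact (smul_eq_zero.mp h2).resolve_left two_ne_zero

theorem body_odd {s : ℕ} {x : OB s} (hx : x ∈ gr s 1) : body s x = 0 := by
  have h : ((body s).comp (invol s)) = body s := by
    apply Algebra.TensorProduct.ext'
    intro a b
    have h1 : (ExteriorAlgebra.algebraMapInv (M := Fin s → ℝ)).comp (grasInvol s)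
        = ExteriorAlgebra.algebraMapInv (R := ℝ) := by
      apply ExteriorAlgebra.hom_ext
      ext v
      have h2 : ∀ w, grasInvol s (ExteriorAlgebra.ι ℝ w) = - ExteriorAlgebra.ι ℝ w :=
        CliffordAlgebra.involute_ι
      simp [h2, ExteriorAlgebra.algebraMapInv]
    have h3 := DFunLike.congr_fun h1 b
    change a * (algebraMap ℝ ℂ) (ExteriorAlgebra.algebraMapInv (grasInvol s b))
      = a * (algebraMap ℝ ℂ) (ExteriorAlgebra.algebraMapInv b)
    rw [← h3]
    rfl
  have h1 := DFunLike.congr_fun h x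
  rw [AlgHom.comp_apply, invol_odd hx, map_neg] at h1
  have h2 : (2 : ℂ) * body s x = 0 := by linear_combination -h1
  exact (mul_eq_zero.mp h2).resolve_left two_ne_zero

/-- The supermatrix which is inverse to an element of `SpO_ℂ(2|1)`. -/
def adj {s : ℕ} (M : Matrix (Fin 3) (Fin 3) (OB s)) : Matrix (Fin 3) (Fin 3) (OB s) :=
  !![M 1 1, -M 0 1, M 2 1; -M 1 0, M 0 0, -M 2 0; -M 1 2, M 0 2, M 2 2]

theorem adj_adj {s : ℕ} (M : Matrix (Fin 3) (Fin 3) (OB s)) : adj (adj M) = M := by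
  ext i j
  fin_cases i <;> fin_cases j <;> simp [adj]

theorem e00 {s : ℕ} (L : SMat s) : L.1 0 0 ∈ gr s 0 := by
  simpa [par3] using L.2 0 0
theorem e01 {s : ℕ} (L : SMat s) : L.1 0 1 ∈ gr s 0 := by
  simpa [par3] using L.2 0 1
theorem e10 {s : ℕ} (L : SMat s) : L.1 1 0 ∈ gr s 0 := by
  simpa [par3] using L.2 1 0
theorem e11 {s : ℕ} (L : SMat s) : L.1 1 1 ∈ gr s 0 := by
  simpa [par3] using L.2 1 1
theorem e22 {s : ℕ} (L : SMat s) : L.1 2 2 ∈ gr s 0 :=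
  gr_two (L.2 2 2)
theorem o02 {s : ℕ} (L : SMat s) : L.1 0 2 ∈ gr s 1 := by
  simpa [par3] using L.2 0 2
theorem o12 {s : ℕ} (L : SMat s) : L.1 1 2 ∈ gr s 1 := by
  simpa [par3] using L.2 1 2
theorem o20 {s : ℕ} (L : SMat s) : L.1 2 0 ∈ gr s 1 := by
  simpa [par3] using L.2 2 0
theorem o21 {s : ℕ} (L : SMat s) : L.1 2 1 ∈ gr s 1 := by
  simpa [par3] using L.2 2 1

theorem adj_mul {s : ℕ} (M N : SMat s) : adj (M.1 * N.1) = adj N.1 * adj M.1 := by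
  have c := fun (x y : OB s) (h : y ∈ gr s 0) => even_comm h x
  have o := fun (x y : OB s) (hx : x ∈ gr s 1) (hy : y ∈ gr s 1) => odd_comm hx hy
  ext i j
  fin_cases i <;> fin_cases j <;>
    simp only [adj, Matrix.mul_apply, Fin.sum_univ_three, Matrix.of_apply, Matrix.cons_val',
      Matrix.cons_val_zero, Matrix.cons_val_one, Matrix.cons_val, Fin.zero_eta, Fin.mk_one,
      Fin.reduceFinMk, neg_mul, mul_neg, neg_neg]
  · rw [c (M.1 1 0) _ (e01 N), c (M.1 1 1) _ (e11 N), o _ _ (o12 M) (o21 N)]; abel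
  · rw [c (M.1 0 0) _ (e01 N), c (M.1 0 1) _ (e11 N), o _ _ (o02 M) (o21 N)]; abel
  · rw [c (M.1 2 0) _ (e01 N), c (M.1 2 1) _ (e11 N), ← c (N.1 2 1) _ (e22 M)]; abel
  · rw [c (M.1 1 0) _ (e00 N), c (M.1 1 1) _ (e10 N), o _ _ (o12 M) (o20 N)]; abel
  · rw [c (M.1 0 0) _ (e00 N), c (M.1 0 1) _ (e10 N), o _ _ (o02 M) (o20 N)]; abel
  · rw [c (M.1 2 0) _ (e00 N), c (M.1 2 1) _ (e10 N), ← c (N.1 2 0) _ (e22 M)]; abel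
  · rw [← c (N.1 0 2) _ (e10 M), ← c (N.1 1 2) _ (e11 M), c (M.1 1 2) _ (e22 N)]; abel
  · rw [← c (N.1 0 2) _ (e00 M), ← c (N.1 1 2) _ (e01 M), c (M.1 0 2) _ (e22 N)]; abel
  · rw [o _ _ (o20 M) (o02 N), o _ _ (o21 M) (o12 N), c (M.1 2 2) _ (e22 N)]; abel

theorem spEqs_iff {s : ℕ} (M : SMat s) : SpEqs M.1 ↔ M.1 * adj M.1 = 1 := by
  have c := fun (x y : OB s) (h : y ∈ gr s 0) => even_comm h x
  have o := fun (x y : OB s) (hx : x ∈ gr s 1) (hy : y ∈ gr s 1) => odd_comm hx hy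
  constructor
  · intro h
    ext i j
    fin_cases i <;> fin_cases j <;>
      simp only [adj, Matrix.mul_apply, Fin.sum_univ_three, Matrix.of_apply, Matrix.cons_val',
        Matrix.cons_val_zero, Matrix.cons_val_one, Matrix.cons_val, Fin.zero_eta, Fin.mk_one,
        Fin.reduceFinMk, mul_neg, Matrix.one_apply, if_true, Fin.isValue]
    · rw [← h.h1, c (M.1 0 1) _ (e10 M)]; abel
    · rw [c (M.1 0 0) _ (e01 M), odd_sq (o02 M)]; simp
    · have := h.h3
      rw [c (M.1 0 2) _ (e22 M), ← this]; simp; abel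
    · rw [c (M.1 1 0) _ (e11 M), odd_sq (o12 M)]; simp
    · rw [← h.h1, o _ _ (o02 M) (o12 M), c (M.1 0 0) _ (e11 M)]; simp; abel
    · have := h.h4
      rw [c (M.1 1 2) _ (e22 M), ← this]; simp; abel
    · have := h.h4
      rw [← this, c (M.1 2 0) _ (e11 M), c (M.1 2 1) _ (e10 M)]; simp; abel
    · have := h.h3
      rw [← this, c (M.1 2 0) _ (e01 M), c (M.1 2 1) _ (e00 M)]; simp
    · rw [← h.h2, o _ _ (o21 M) (o20 M), two_mul, pow_two]; simp; abel
  · intro h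
    have e := fun i j => congrFun (congrFun h i) j
    have f00 := e 0 0
    have e02 := e 0 2
    have e12 := e 1 2
    have f22 := e 2 2
    simp only [adj, Matrix.mul_apply, Fin.sum_univ_three, Matrix.of_apply, Matrix.cons_val',
        Matrix.cons_val_zero, Matrix.cons_val_one, Matrix.cons_val, Fin.isValue,
        mul_neg, Matrix.one_apply, if_true] at f00 e02 e12 f22
    refine ⟨?_, ?_, ?_, ?_⟩
    · rw [← f00, c (M.1 0 1) _ (e10 M)]; abel
    · rw [← f22, o _ _ (o21 M) (o20 M), two_mul, pow_two]; abel
    · have e02' : M.1 0 0 * M.1 2 1 + -(M.1 0 1 * M.1 2 0) + M.1 0 2 * M.1 2 2 = 0 := by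
        simpa using e02
      rw [c (M.1 0 2) _ (e22 M)] at e02'
      rw [← sub_eq_zero, ← neg_eq_zero, ← e02']; abel
    · have e12' : M.1 1 0 * M.1 2 1 + -(M.1 1 1 * M.1 2 0) + M.1 1 2 * M.1 2 2 = 0 := by
        simpa using e12
      rw [c (M.1 1 2) _ (e22 M)] at e12'
      rw [← sub_eq_zero, ← neg_eq_zero, ← e12']; abel

theorem inv_eq_adj {s : ℕ} (L : GL21 s) (h : SpEqs L.1.1) : (L⁻¹).1.1 = adj L.1.1 := by
  have h1 := (spEqs_iff L.1).mp h
  have h2 : (L⁻¹).1.1 * L.1.1 = 1 := congrArg Subtype.val L.inv_mul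
  calc (L⁻¹).1.1 = (L⁻¹).1.1 * (L.1.1 * adj L.1.1) := by rw [h1, mul_one]
    _ = adj L.1.1 := by rw [← mul_assoc, h2, one_mul]

/-- The points of `SpO_ℂ(2|1)`. -/
def SpO (s : ℕ) : Subgroup (GL21 s) where
  carrier := {L | SpEqs (ent L.1)}
  mul_mem' := by
    intro L N hL hN
    have h1 := (spEqs_iff L.1).mp hL
    have h2 := (spEqs_iff N.1).mp hN
    refine (spEqs_iff (L.1 * N.1)).mpr ?_
    change L.1.1 * N.1.1 * adj (L.1.1 * N.1.1) = 1
    rw [adj_mul, mul_assoc, ← mul_assoc N.1.1, h2, one_mul, h1]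
  one_mem' := by
    refine (spEqs_iff 1).mpr ?_
    ext i j
    fin_cases i <;> fin_cases j <;> simp [adj]
  inv_mem' := by
    intro L hL
    refine (spEqs_iff (L⁻¹).1).mpr ?_
    have h := inv_eq_adj L hL
    have h2 : (L⁻¹).1.1 * L.1.1 = 1 := congrArg Subtype.val L.inv_mul
    rw [h] at h2 ⊢
    rwa [adj_adj]

/-- The points of `SC(ℙ^{1|1})`, realised as the connected component of `SpO_ℂ(2|1)` on which the
reduction of the lower right entry is `1`. -/
def SC (s : ℕ) : Subgroup (GL21 s) where
  carrier := {L | L ∈ SpO s ∧ body s (ent L.1 2 2) = 1}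
  mul_mem' := by
    rintro L N ⟨hL, hL'⟩ ⟨hN, hN'⟩
    refine ⟨mul_mem hL hN, ?_⟩
    change body s ((L.1.1 * N.1.1) 2 2) = 1
    have h1 : body s (L.1.1 2 2) = 1 := hL'
    have h2 : body s (N.1.1 2 2) = 1 := hN'
    rw [Matrix.mul_apply, Fin.sum_univ_three, map_add, map_add, map_mul, map_mul, map_mul,
      body_odd (o20 L.1), body_odd (o21 L.1), h1, h2]
    simp
  one_mem' := ⟨one_mem _, by
    change body s ((1 : Matrix (Fin 3) (Fin 3) (OB s)) 2 2) = 1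
    simp⟩
  inv_mem' := by
    rintro L ⟨hL, hL'⟩
    refine ⟨inv_mem hL, ?_⟩
    change body s ((L⁻¹).1.1 2 2) = 1
    rw [inv_eq_adj L hL]
    exact hL'

/-- The matrix entries of a point of `SC(ℙ^{1|1})`. -/
def SC.mat {s : ℕ} (L : SC s) : Matrix (Fin 3) (Fin 3) (OB s) := ent L.1.1

theorem SC.mat_injective (s : ℕ) : Function.Injective (SC.mat (s := s)) := by
  intro L N h
  exact Subtype.ext (Units.ext (Subtype.ext h))

theorem body_ob {s t : ℕ} (φ : SPHom s t) (x : OB s) : body t (φ.ob x) = body s x := by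
  have h : (body t).comp φ.ob = body s := by
    apply Algebra.TensorProduct.ext'
    intro a b
    have h1 : (ExteriorAlgebra.algebraMapInv (M := Fin t → ℝ)).comp φ.hom
        = ExteriorAlgebra.algebraMapInv (R := ℝ) := by
      apply ExteriorAlgebra.hom_ext
      ext v
      have h2 : grasInvol s (ExteriorAlgebra.ι ℝ (Pi.single v 1))
          = - ExteriorAlgebra.ι ℝ (Pi.single v 1) := CliffordAlgebra.involute_ι _
      have h3 := ExteriorAlgebra.comp_ι_sq_zero
        ((ExteriorAlgebra.algebraMapInv (M := Fin t → ℝ)).comp φ.hom) (Pi.single v (1 : ℝ))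
      have h4 := mul_self_eq_zero.mp h3
      simpa [ExteriorAlgebra.algebraMapInv] using h4
    have h3 := DFunLike.congr_fun h1 b
    change a * (algebraMap ℝ ℂ) (ExteriorAlgebra.algebraMapInv (φ.hom b))
      = a * (algebraMap ℝ ℂ) (ExteriorAlgebra.algebraMapInv b)
    rw [← h3]
    rfl
  exact DFunLike.congr_fun h x

/-- Entrywise pullback of even supermatrices along a morphism of superpoints. -/
def SMat.map {s t : ℕ} (φ : SPHom s t) : SMat s →+* SMat t :=
  ((φ.ob : OB s →+* OB t).mapMatrix).restrict (SMat s) (SMat t)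
    (fun _ hM i j => ob_mem_gr φ (hM i j))

theorem SMat.map_adj {s t : ℕ} (φ : SPHom s t) (M : SMat s) :
    adj (SMat.map φ M).1 = ((φ.ob : OB s →+* OB t).mapMatrix) (adj M.1) := by
  ext i j
  fin_cases i <;> fin_cases j <;> simp [adj] <;> rfl

/-- Functoriality of the points of `SC(ℙ^{1|1})`. -/
def SC.map {s t : ℕ} (φ : SPHom s t) (L : SC s) : SC t :=
  ⟨Units.map (SMat.map φ : SMat s →* SMat t) L.1, by
    refine ⟨(spEqs_iff (SMat.map φ L.1.1)).mpr ?_, ?_⟩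
    · have h := (spEqs_iff L.1.1).mp L.2.1
      rw [SMat.map_adj]
      change ((φ.ob : OB s →+* OB t).mapMatrix) L.1.1.1 *
        ((φ.ob : OB s →+* OB t).mapMatrix) (adj L.1.1.1) = 1
      rw [← map_mul, h, map_one]
    · change body t (φ.ob (L.1.1.1 2 2)) = 1
      rw [body_ob]
      exact L.2.2⟩

/-- `SC(ℙ^{1|1})` with the matrix entries as coordinates in `ℂ^{5|4}`. -/
def SCSpace : SSpace where
  ι := Fin 3 × Fin 3
  fin := inferInstance
  par := matPar
  pts s := SC s
  map := SC.map
  coord L := fun ij => ⟨SC.mat L ij.1 ij.2, L.1.1.2 ij.1 ij.2⟩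
  coord_injective s L N h := SC.mat_injective s <| by
    ext i j
    exact congrArg Subtype.val (congrFun h (i, j))
  coord_map _ _ := rfl

instance (s : ℕ) : Group (SCSpace.pts s) := inferInstanceAs (Group (SC s))

/-! ### The group `SL_ℂ(2)` and its embedding -/

/-- The points of `SL_ℂ(2)`: two by two matrices of determinant `1` over the even functions. -/
abbrev SL2 (s : ℕ) : Type := Matrix.SpecialLinearGroup (Fin 2) (Even s)

/-- `SL_ℂ(2)` with the matrix entries as coordinates in `ℂ^{4|0}`. -/
def SL2Space : SSpace where
  ι := Fin 2 × Fin 2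
  fin := inferInstance
  par _ := 0
  pts s := SL2 s
  map φ l := Matrix.SpecialLinearGroup.map φ.even l
  coord l := fun ij => ⟨(l.1 ij.1 ij.2).1, (l.1 ij.1 ij.2).2⟩
  coord_injective s l m h := by
    ext i j
    exact congrArg Subtype.val (congrFun h (i, j))
  coord_map _ _ := rfl

instance (s : ℕ) : Group (SL2Space.pts s) := inferInstanceAs (Group (SL2 s))

/-- The block diagonal supermatrix with upper left block `m` and lower right entry `1`. -/
def blockMat {s : ℕ} (m : Matrix (Fin 2) (Fin 2) (Even s)) : Matrix (Fin 3) (Fin 3) (OB s) :=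
  !![m 0 0, m 0 1, 0; m 1 0, m 1 1, 0; 0, 0, 1]

/-- The block diagonal embedding of two by two matrices over the even functions into the even
supermatrices. -/
def blockHom (s : ℕ) : Matrix (Fin 2) (Fin 2) (Even s) →* SMat s where
  toFun m := ⟨blockMat m, by
    intro i j
    fin_cases i <;> fin_cases j
    · exact (show (0 : ZMod 2) + 0 = 0 by decide) ▸ (m 0 0).2
    · exact (show (0 : ZMod 2) + 0 = 0 by decide) ▸ (m 0 1).2
    · exact Submodule.zero_mem _
    · exact (show (0 : ZMod 2) + 0 = 0 by decide) ▸ (m 1 0).2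
    · exact (show (0 : ZMod 2) + 0 = 0 by decide) ▸ (m 1 1).2
    · exact Submodule.zero_mem _
    · exact Submodule.zero_mem _
    · exact Submodule.zero_mem _
    · exact (show (1 : ZMod 2) + 1 = 0 by decide) ▸ one_mem_gr s⟩
  map_one' := by
    apply Subtype.ext
    ext i j
    fin_cases i <;> fin_cases j <;> simp [blockMat]
  map_mul' m n := by
    apply Subtype.ext
    ext i j
    fin_cases i <;> fin_cases j <;>
      simp [blockMat, Matrix.mul_apply, Fin.sum_univ_two]

theorem blockHom_mem {s : ℕ} (l : SL2 s) (u : GL21 s) (hu : u.1 = blockHom s l.1) :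
    u ∈ SC s := by
  have hd : l.1 0 0 * l.1 1 1 - l.1 0 1 * l.1 1 0 = 1 := by
    rw [← Matrix.det_fin_two]; exact l.2
  have hd' : (l.1 0 0 : OB s) * l.1 1 1 - l.1 1 0 * l.1 0 1 = 1 := by
    rw [mul_comm (l.1 0 1)] at hd
    exact congrArg Subtype.val hd
  have hm : ent u.1 = blockMat l.1 := congrArg Subtype.val hu
  refine ⟨?_, ?_⟩
  · change SpEqs (ent u.1)
    rw [hm]
    exact ⟨by simpa [blockMat] using hd', by simp [blockMat], by simp [blockMat],
      by simp [blockMat]⟩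
  · rw [hm]
    simp [blockMat]

/-- The group homomorphism `SL_ℂ(2) → SC(ℙ^{1|1})`, `l ↦ diag(l, 1)`. -/
def toSC (s : ℕ) : SL2 s →* SC s :=
  (((blockHom s).comp Matrix.SpecialLinearGroup.coeMonoidHom).toHomUnits).codRestrict (SC s)
    (fun l => blockHom_mem l _ rfl)

/-! ### Supersymmetry transformations -/

/-- Two odd coordinates. -/
def oddPar (_ : Fin 2) : ZMod 2 := 1

/-- The linear superspace `ℂ^{0|2}`. -/
def C02 : SSpace := linSpace oddPar

/-- The supersymmetry matrix with parameters `α`, `β`. -/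
def susyMat {s : ℕ} (α β : OB s) : Matrix (Fin 3) (Fin 3) (OB s) :=
  !![1 + (1 / 2 : ℂ) • (α * β), 0, -β;
     0, 1 + (1 / 2 : ℂ) • (α * β), α;
     α, β, 1 - α * β]

theorem susyMat_mem {s : ℕ} {α β : OB s} (hα : α ∈ gr s 1) (hβ : β ∈ gr s 1) :
    susyMat α β ∈ SMat s := by
  have h := gr_two (mul_mem_gr hα hβ)
  have h0 : (0 : ZMod 2) + 0 = 0 := by decide
  have h1 : (1 : ZMod 2) + 1 = 0 := by decide
  have h2 : (0 : ZMod 2) + 1 = 1 := by decide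
  have h3 : (1 : ZMod 2) + 0 = 1 := by decide
  have hd : 1 + (1 / 2 : ℂ) • (α * β) ∈ gr s 0 :=
    Submodule.add_mem _ (one_mem_gr s) (Submodule.smul_mem _ _ h)
  intro i j
  fin_cases i <;> fin_cases j
  · exact h0.symm ▸ hd
  · exact Submodule.zero_mem _
  · exact h2.symm ▸ Submodule.neg_mem _ hβ
  · exact Submodule.zero_mem _
  · exact h0.symm ▸ hd
  · exact h2.symm ▸ hα
  · exact h3.symm ▸ hα
  · exact h3.symm ▸ hβ
  · exact h1.symm ▸ Submodule.sub_mem _ (one_mem_gr s) h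

theorem susyMat_eqs {s : ℕ} {α β : OB s} (hα : α ∈ gr s 1) (hβ : β ∈ gr s 1) :
    SpEqs (susyMat α β) := by
  have ha := odd_sq hα
  have hb := odd_sq hβ
  have hba : β * α = -(α * β) := odd_comm hβ hα
  have h1 : α * β * (α * β) = 0 := by
    rw [mul_assoc, ← mul_assoc β, hba, neg_mul, mul_assoc, hb]; simp
  have h2 : α * β * α = 0 := by
    rw [mul_assoc, hba, mul_neg, ← mul_assoc, ha]; simp
  have h3 : α * β * β = 0 := by rw [mul_assoc, hb, mul_zero]
  have hh : (1 / 2 : ℂ) • (α * β) + (1 / 2 : ℂ) • (α * β) = α * β := by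
    rw [← add_smul]; norm_num
  refine ⟨?_, ?_, ?_, ?_⟩
  · simp only [susyMat, Matrix.of_apply, Matrix.cons_val', Matrix.cons_val_zero,
      Matrix.cons_val_one, Matrix.cons_val, Fin.isValue]
    rw [neg_mul, hba, mul_add, add_mul, add_mul, smul_mul_smul_comm, h1, one_mul, mul_one,
      one_mul, smul_zero, zero_mul, sub_zero, neg_neg, add_zero, add_assoc, hh, add_sub_cancel_right]
  · simp only [susyMat, Matrix.of_apply, Matrix.cons_val', Matrix.cons_val_zero,
      Matrix.cons_val_one, Matrix.cons_val, Fin.isValue]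
    rw [pow_two, mul_sub, sub_mul, sub_mul, h1, two_mul]
    simp
  · simp [susyMat, add_mul, sub_mul, h3]
  · simp [susyMat, add_mul, sub_mul, h2]

theorem susyMat_adj {s : ℕ} (α β : OB s) : adj (susyMat α β) = susyMat (-α) (-β) := by
  ext i j
  fin_cases i <;> fin_cases j <;> simp [adj, susyMat]

/-- The supersymmetry transformation with parameters `v = (α, β)`, as a point of `SC(ℙ^{1|1})`. -/
def susy (s : ℕ) (v : SVec oddPar s) : SC s :=
  ⟨⟨⟨susyMat (v 0) (v 1), susyMat_mem (v 0).2 (v 1).2⟩,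
    ⟨susyMat (-(v 0)) (-(v 1)), susyMat_mem (-(v 0)).2 (-(v 1)).2⟩,
    by
      apply Subtype.ext
      have h := (spEqs_iff ⟨_, susyMat_mem (v 0).2 (v 1).2⟩).mp (susyMat_eqs (v 0).2 (v 1).2)
      rw [susyMat_adj] at h
      exact h,
    by
      apply Subtype.ext
      have h := (spEqs_iff ⟨_, susyMat_mem (-(v 0)).2 (-(v 1)).2⟩).mp
        (susyMat_eqs (-(v 0)).2 (-(v 1)).2)
      rw [susyMat_adj] at h
      simpa using h⟩,
    susyMat_eqs (v 0).2 (v 1).2, by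
      change body s (1 - (v 0 : OB s) * v 1) = 1
      rw [map_sub, map_mul, body_odd (v 0).2]
      simp⟩

/-! ### The space of cosets -/

/-- The `ℝ^{0|s}`-points of the coset space `SL_ℂ(2) \ SC(ℙ^{1|1})`: the classes `SL_ℂ(2) · L`. -/
abbrev Coset (s : ℕ) : Type := Quotient (QuotientGroup.rightRel (toSC s).range)

/-- The class `SL_ℂ(2) · L` of `L`. -/
def cosetMk (s : ℕ) (L : SC s) : Coset s := Quotient.mk _ L

/-- The action of `SL_ℂ(2)` on `SC(ℙ^{1|1})` by left multiplication. -/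
def leftAct (s : ℕ) (l : SL2 s) (L : SC s) : SC s := toSC s l * L

end SG

end

/-!
Every point `L` of `SC(ℙ^{1|1})` satisfies `e² + 2αβ = 1`, where `αβ` is nilpotent and the
reduction of `e` is `1`, so `e = 1 - αβ`. Since `α` and `β` square to zero, the remaining equations
then say `ad - bc = 1 + αβ`, `γ = cα - aβ` and `δ = dα - bβ`. So `L` is determined by `(α, β)` and
its upper left block, and dividing that block by `1 + ½αβ`, a square root of `1 + αβ`, gives the
unique element of `SL_ℂ(2)` that carries `S(α, β)` to `L`.

The factorisation and its inverse are polynomial in the entries, and polynomials are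
superholomorphic; hence `SL_ℂ(2) × ℂ^{0|2} → SC(ℙ^{1|1})` is an isomorphism of supermanifolds. The
coset of `L` is recorded by `(α, β)`, and the left translates of `S` are superholomorphic sections
of `L ↦ (α, β)`, one through every reduced point, which gives submersivity and the universal
property. The solved equations also cut out `SC(ℙ^{1|1})` regularly in `ℂ^{5|4}`: three of them are
graphs, and scaling the upper left block changes `ad - bc` arbitrarily.
-/

noncomputable section

namespace SG

section Grading

variable {s t : ℕ} {k l : ZMod 2}

theorem sgn_mul_self (k : ZMod 2) : sgn k * sgn k = 1 := by
  unfold sgn; split_ifs <;> norm_num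

theorem OB.algHom_ext {A : Type*} [Ring A] [Algebra ℂ A] {f g : OB s →ₐ[ℂ] A}
    (h : ∀ v, f (gen (ExteriorAlgebra.ι ℝ v)) = g (gen (ExteriorAlgebra.ι ℝ v))) : f = g := by
  have h_gen (w : Gras s) : f (gen w) = g (gen w) := by
    induction w using ExteriorAlgebra.induction with
    | algebraMap r => rw [gen_algebraMap, f.commutes, g.commutes]
    | ι v => exact h v
    | mul a b ha hb => rw [gen_mul', map_mul, map_mul, ha, hb]
    | add a b ha hb => rw [gen_add, map_add, map_add, ha, hb]
  ext x
  induction x using OB.induction with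
  | zero => rw [map_zero, map_zero]
  | tmul z w => rw [map_smul, map_smul, h_gen]
  | add a b ha hb => rw [map_add, map_add, ha, hb]

theorem gen_ι_mem_gr_one (v : Fin s → ℝ) : (gen (ExteriorAlgebra.ι ℝ v) : OB s) ∈ gr s 1 := by
  rw [mem_gr, invol_gen, show grasInvol s (ExteriorAlgebra.ι ℝ v) = -ExteriorAlgebra.ι ℝ v from
    CliffordAlgebra.involute_ι v, sgn, if_neg one_ne_zero, neg_one_smul]
  exact TensorProduct.tmul_neg _ _

theorem invol_invol (x : OB s) : invol s (invol s x) = x := by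
  have h : (invol s).comp (invol s) = AlgHom.id ℂ (OB s) :=
    OB.algHom_ext fun v => by
      simp [invol_odd (gen_ι_mem_gr_one v)]
  exact DFunLike.congr_fun h x

/-- The projection of `𝒪_B ⊗ ℂ` onto its part of parity `k`. -/
def grProj (s : ℕ) (k : ZMod 2) : OB s →L[ℂ] gr s k :=
  (LinearMap.codRestrict (gr s k)
    ((1 / 2 : ℂ) • (LinearMap.id + sgn k • (invol s).toLinearMap)) fun x => by
      simp only [mem_gr, LinearMap.smul_apply, LinearMap.add_apply, LinearMap.id_apply,
        AlgHom.toLinearMap_apply, map_smul, map_add, invol_invol]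
      rw [smul_comm (sgn k), smul_add (sgn k), smul_smul, sgn_mul_self, one_smul,
        add_comm]).toContinuousLinearMap

theorem coe_grProj (k : ZMod 2) (x : OB s) :
    (grProj s k x : OB s) = (1 / 2 : ℂ) • (x + sgn k • invol s x) := rfl

theorem coe_grProj_of_mem {x : OB s} (hx : x ∈ gr s k) : (grProj s k x : OB s) = x := by
  rw [coe_grProj, mem_gr.mp hx, smul_smul, sgn_mul_self, one_smul, ← two_smul ℂ, smul_smul]
  norm_num

theorem grProj_coe (x : gr s k) : grProj s k x = x :=
  Subtype.ext (coe_grProj_of_mem x.2)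

theorem ob_grProj (φ : SPHom s t) (k : ZMod 2) (x : OB s) :
    φ.ob (grProj s k x) = grProj t k (φ.ob x) := by
  simp only [coe_grProj, map_smul, map_add, ob_invol]

theorem coe_grProj_even_mul (k : ZMod 2) (l : Even s) (x : OB s) :
    (grProj s k (l * x) : OB s) = l * grProj s k x := by
  simp only [coe_grProj, map_mul, invol_even l.2, mul_smul_comm, mul_add]

end Grading

section Nilpotents

variable {s : ℕ}

theorem grProj_zero_mul (x y : OB s) : (grProj s 0 (x * y) : OB s) =
    grProj s 0 x * grProj s 0 y + grProj s 1 x * grProj s 1 y := by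
  simp only [coe_grProj, map_mul, sgn, if_true, if_neg one_ne_zero, smul_mul_smul_comm,
    add_mul, mul_add, one_smul, neg_smul, neg_mul, mul_neg]
  module

theorem odd_mul_odd_sq {α β : OB s} (hα : α ∈ gr s 1) (hβ : β ∈ gr s 1) :
    α * β * (α * β) = 0 := by
  rw [even_comm (gr_two (mul_mem_gr hα hβ)) (α * β), mul_assoc, ← mul_assoc β, odd_comm hβ hα,
    neg_mul, mul_assoc, odd_sq hβ, mul_zero, neg_zero, mul_zero]

/-- The even part of an element of `𝒪_B ⊗ ℂ` modulo nilpotents. It is multiplicative because a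
product of two odd elements squares to zero. -/
def evenResidue (s : ℕ) : OB s →ₐ[ℂ] Even s ⧸ nilradical (Even s) :=
  AlgHom.ofLinearMap
    ((Ideal.Quotient.mkₐ ℂ (nilradical (Even s))).toLinearMap ∘ₗ
      LinearMap.codRestrict (Even s).toSubmodule ((gr s 0).subtype ∘ₗ (grProj s 0).toLinearMap)
        fun x => (grProj s 0 x).2)
    (by
      refine congrArg (Ideal.Quotient.mk _) (Subtype.ext ?_)
      exact coe_grProj_of_mem (one_mem_gr s))
    fun x y => by
      refine (Ideal.Quotient.eq.mpr (mem_nilradical.mpr ⟨2, Subtype.ext ?_⟩)).trans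
        (map_mul (Ideal.Quotient.mk _) _ _)
      change ((grProj s 0 (x * y) : OB s) - grProj s 0 x * grProj s 0 y) ^ 2 = 0
      rw [grProj_zero_mul, add_sub_cancel_left, pow_two]
      exact odd_mul_odd_sq (grProj s 1 x).2 (grProj s 1 y).2

theorem evenResidue_coe (x : Even s) : evenResidue s x = Ideal.Quotient.mk _ x :=
  congrArg (Ideal.Quotient.mk _) (Subtype.ext (coe_grProj_of_mem x.2))

theorem evenResidue_odd {x : OB s} (hx : x ∈ gr s 1) : evenResidue s x = 0 := by
  refine (congrArg (Ideal.Quotient.mk _) (Subtype.ext ?_)).trans (map_zero _)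
  change (grProj s 0 x : OB s) = 0
  rw [coe_grProj, invol_odd hx, sgn, if_pos rfl, one_smul, add_neg_cancel, smul_zero]

theorem evenResidue_eq_algebraMap_body (x : OB s) :
    evenResidue s x = algebraMap ℂ _ (body s x) := by
  have h : evenResidue s = (Algebra.ofId ℂ _).comp (body s) := OB.algHom_ext fun v => by
    have hv := gen_ι_mem_gr_one v
    rw [AlgHom.comp_apply, evenResidue_odd hv, body_odd hv, map_zero]
  exact DFunLike.congr_fun h x

theorem isNilpotent_of_body_eq_zero {x : Even s} (hx : body s x = 0) : IsNilpotent x := by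
  rw [← mem_nilradical, ← Ideal.Quotient.eq_zero_iff_mem, ← evenResidue_coe,
    evenResidue_eq_algebraMap_body, hx, map_zero]

theorem isUnit_of_body_ne_zero {x : Even s} (hx : body s x ≠ 0) : IsUnit x := by
  have h_nil : IsNilpotent (x - algebraMap ℂ (Even s) (body s x)) :=
    isNilpotent_of_body_eq_zero <| by
      rw [Subalgebra.coe_sub, Subalgebra.coe_algebraMap, map_sub, AlgHom.commutes,
        Algebra.algebraMap_self_apply, sub_self]
  have h_unit : IsUnit (algebraMap ℂ (Even s) (body s x)) := hx.isUnit.map _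
  simpa only [add_sub_cancel] using h_nil.isUnit_add_left_of_commute h_unit (Commute.all _ _)

theorem eq_one_sub_of_sq_add_two_mul {e k : Even s} (hk : k * k = 0) (he : e ^ 2 + 2 * k = 1)
    (h_body : body s e = 1) : e = 1 - k := by
  have hk_body : body s k = 0 := mul_self_eq_zero.mp <| by
    rw [← map_mul, ← Subalgebra.coe_mul, hk, Subalgebra.coe_zero, map_zero]
  -- `e ^ 2 = (1 - k) ^ 2`, and `e + (1 - k)` has body `2`
  have h_unit : IsUnit (e + (1 - k)) := isUnit_of_body_ne_zero <| by
    simp only [Subalgebra.coe_add, Subalgebra.coe_sub, Subalgebra.coe_one, map_add, map_sub,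
      map_one, h_body, hk_body]
    norm_num
  refine sub_eq_zero.mp ((IsUnit.mul_right_eq_zero h_unit).mp ?_)
  linear_combination he - hk

end Nilpotents

/-! ### Superholomorphic functions -/

section SuperholomorphicFunctions

variable {ι κ : Type} {p : ι → ZMod 2} {q : κ → ZMod 2} {s : ℕ}

theorem SVec.map_apply {t : ℕ} (φ : SPHom s t) (x : SVec p s) (i : ι) :
    (x.map φ i : OB t) = φ.ob (x i) := rfl

theorem SVec.evenSMul_apply (l : Even s) (x : SVec p s) (i : ι) :
    (x.evenSMul l i : OB s) = l * x i := rfl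

/-- A superholomorphic function, of arbitrary parity, on the linear superspace with coordinates of
parities `p`: the analogue of `SHolOn` with values in all of `𝒪_B ⊗ ℂ`. -/
structure IsSHolFun {ι : Type} [Fintype ι] {p : ι → ZMod 2} (f : ∀ s, SVec p s → OB s) : Prop where
  natural : ∀ (s t : ℕ) (φ : SPHom s t) (x : SVec p s), f t (x.map φ) = φ.ob (f s x)
  differentiable : ∀ s, Differentiable ℂ (f s)
  evenLinear : ∀ s (x v : SVec p s) (l : Even s),
    fderiv ℂ (f s) x (v.evenSMul l) = l * fderiv ℂ (f s) x v

/-- The multiplication of `𝒪_B ⊗ ℂ` as a continuous bilinear map, which differentiates products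
although the norm of `𝒪_B ⊗ ℂ` is not submultiplicative. -/
def mulCLM (s : ℕ) : OB s →L[ℂ] OB s →L[ℂ] OB s :=
  (LinearMap.mul ℂ (OB s)).toContinuousBilinearMap

/-- Evaluation of the `i`-th coordinate as a continuous linear map. -/
def coordCLM (p : ι → ZMod 2) (i : ι) (s : ℕ) : SVec p s →L[ℂ] OB s :=
  (gr s (p i)).subtypeL ∘L ContinuousLinearMap.proj i

theorem fderiv_coord (i : ι) (x v : SVec p s) :
    fderiv ℂ (fun y : SVec p s => (y i : OB s)) x v = v i :=
  DFunLike.congr_fun (coordCLM p i s).hasFDerivAt.fderiv v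

variable [Fintype ι]

namespace IsSHolFun

variable {f g : ∀ s, SVec p s → OB s}

theorem algebraMap (c : ℂ) : IsSHolFun fun s (_ : SVec p s) => algebraMap ℂ (OB s) c where
  natural _ _ φ _ := (φ.ob.commutes c).symm
  differentiable _ := differentiable_const _
  evenLinear s x v l := by
    rw [fderiv_fun_const]
    exact (mul_zero _).symm

theorem coord (i : ι) : IsSHolFun fun s (x : SVec p s) => (x i : OB s) where
  natural _ _ _ _ := rfl
  differentiable s := (coordCLM p i s).differentiable
  evenLinear s x v l := by rw [fderiv_coord, fderiv_coord, SVec.evenSMul_apply]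

theorem fderiv_add (hf : IsSHolFun f) (hg : IsSHolFun g) (x v : SVec p s) :
    fderiv ℂ ((f + g) s) x v = fderiv ℂ (f s) x v + fderiv ℂ (g s) x v :=
  DFunLike.congr_fun (_root_.fderiv_add (𝕜 := ℂ) (E := SVec p s) (F := OB s) (f := f s) (g := g s)
    (hf.differentiable s x) (hg.differentiable s x)) v

theorem add (hf : IsSHolFun f) (hg : IsSHolFun g) : IsSHolFun (f + g) where
  natural s t φ x := by
    simp only [Pi.add_apply, map_add, hf.natural s t φ x, hg.natural s t φ x]
  differentiable s := Differentiable.add (𝕜 := ℂ) (E := SVec p s) (F := OB s)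
    (f := f s) (g := g s) (hf.differentiable s) (hg.differentiable s)
  evenLinear s x v l := by
    simp only [fderiv_add hf hg, hf.evenLinear, hg.evenLinear, mul_add]

theorem hasFDerivAt_mul (hf : IsSHolFun f) (hg : IsSHolFun g) (x : SVec p s) :
    HasFDerivAt ((f * g) s)
      ((mulCLM s).precompR (SVec p s) (f s x) (fderiv ℂ (g s) x) +
        (mulCLM s).precompL (SVec p s) (fderiv ℂ (f s) x) (g s x)) x :=
  (mulCLM s).hasFDerivAt_of_bilinear (hf.differentiable s x).hasFDerivAt
    (hg.differentiable s x).hasFDerivAt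

theorem fderiv_mul (hf : IsSHolFun f) (hg : IsSHolFun g) (x v : SVec p s) :
    fderiv ℂ ((f * g) s) x v = f s x * fderiv ℂ (g s) x v + fderiv ℂ (f s) x v * g s x :=
  DFunLike.congr_fun (hasFDerivAt_mul hf hg x).fderiv v

theorem mul (hf : IsSHolFun f) (hg : IsSHolFun g) : IsSHolFun (f * g) where
  natural s t φ x := by
    simp only [Pi.mul_apply, map_mul, hf.natural s t φ x, hg.natural s t φ x]
  differentiable s x := (hasFDerivAt_mul hf hg x).differentiableAt
  evenLinear s x v l := by
    rw [fderiv_mul hf hg, fderiv_mul hf hg, hf.evenLinear, hg.evenLinear, ← mul_assoc,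
      even_comm l.2 (f s x), mul_assoc, mul_assoc, ← mul_add]

end IsSHolFun

/-- The algebra of superholomorphic functions on the linear superspace with coordinates of
parities `p`. -/
def SHolFun (p : ι → ZMod 2) : Subalgebra ℂ (∀ s, SVec p s → OB s) where
  carrier := {f | IsSHolFun f}
  algebraMap_mem' := IsSHolFun.algebraMap
  add_mem' := IsSHolFun.add
  mul_mem' := IsSHolFun.mul

namespace SHolFun

/-- The value of a superholomorphic function at a point. -/
def eval (x : SVec p s) : SHolFun p →ₐ[ℂ] OB s :=
  (((Pi.evalAlgHom ℂ (fun _ => OB s) x).comp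
    (Pi.evalAlgHom ℂ (fun s => SVec p s → OB s) s)).comp (SHolFun p).val)

/-- The coordinate functions. -/
def coord (p : ι → ZMod 2) (i : ι) : SHolFun p := ⟨_, IsSHolFun.coord i⟩

@[simp]
theorem eval_coord (x : SVec p s) (i : ι) : eval x (coord p i) = x i := rfl

theorem eval_map {t : ℕ} (φ : SPHom s t) (x : SVec p s) (f : SHolFun p) :
    eval (x.map φ) f = φ.ob (eval x f) :=
  f.2.natural s t φ x

/-- The derivative of superholomorphic functions at the point `x` in the direction `v`. -/
def tangent (x v : SVec p s) : SHolFun p →ₗ[ℂ] OB s where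
  toFun f := fderiv ℂ (f.1 s) x v
  map_add' f g := IsSHolFun.fderiv_add f.2 g.2 x v
  map_smul' c f := DFunLike.congr_fun (fderiv_const_smul (𝕜 := ℂ) (E := SVec p s) (F := OB s)
    (f := f.1 s) (f.2.differentiable s x) c) v

theorem hasFDerivAt_eval (x : SVec p s) (f : SHolFun p) :
    HasFDerivAt (fun y : SVec p s => eval y f) (fderiv ℂ (f.1 s) x) x :=
  (f.2.differentiable s x).hasFDerivAt

@[simp]
theorem tangent_coord (x v : SVec p s) (i : ι) : tangent x v (coord p i) = v i :=
  fderiv_coord i x v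

@[simp]
theorem tangent_mul (x v : SVec p s) (f g : SHolFun p) :
    tangent x v (f * g) = eval x f * tangent x v g + tangent x v f * eval x g :=
  IsSHolFun.fderiv_mul f.2 g.2 x v

@[simp]
theorem tangent_one (x v : SVec p s) : tangent x v (1 : SHolFun p) = 0 :=
  congrArg (fun L : SVec p s →L[ℂ] OB s => L v)
    (hasFDerivAt_const (𝕜 := ℂ) (E := SVec p s) (1 : OB s) x).fderiv

/-- The map to the linear superspace with coordinates of parities `q` whose `j`-th component is the
part of parity `q j` of `F j`. Projecting makes every family `F` define a map. -/
def toMap (q : κ → ZMod 2) (F : κ → SHolFun p) (s : ℕ) (x : SVec p s) : SVec q s :=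
  fun j => grProj s (q j) (eval x (F j))

theorem hasFDerivAt_toMap (F : κ → SHolFun p) (x : SVec p s) :
    HasFDerivAt (toMap q F s)
      (ContinuousLinearMap.pi fun j => grProj s (q j) ∘L fderiv ℂ ((F j).1 s) x) x :=
  hasFDerivAt_pi.mpr fun j => ((grProj s (q j)).hasFDerivAt (x := eval x (F j))).comp x
    (f := fun y : SVec p s => eval y (F j)) (hasFDerivAt_eval x (F j))

theorem fderiv_toMap (F : κ → SHolFun p) (x v : SVec p s) (j : κ) :
    fderiv ℂ (toMap q F s) x v j = grProj s (q j) (tangent x v (F j)) :=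
  congrFun (DFunLike.congr_fun (hasFDerivAt_toMap (q := q) F x).fderiv v) j

theorem sHolOn_toMap [Fintype κ] (q : κ → ZMod 2) (U : Set (ι → ℂ)) (F : κ → SHolFun p) :
    SHolOn U (toMap q F) where
  natural s t φ x _ := funext fun j => Subtype.ext <| by
    simp only [toMap, eval_map, SVec.map_apply, ob_grProj]
  holo s x _ := (hasFDerivAt_toMap F x).differentiableAt.differentiableWithinAt
  evenLinear s x _ l v := funext fun j => Subtype.ext <| by
    rw [fderiv_toMap, SVec.evenSMul_apply, fderiv_toMap, ← coe_grProj_even_mul]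
    exact congrArg (fun y => (grProj s (q j) y : OB s)) ((F j).2.evenLinear s x v l)

theorem surjective_fderiv_toMap {F : κ → SHolFun p} {x : SVec p s}
    (h : ∀ w : SVec q s, ∃ v, ∀ j, tangent x v (F j) = w j) :
    Function.Surjective (fderiv ℂ (toMap q F s) x) := fun w => by
  obtain ⟨v, hv⟩ := h w
  exact ⟨v, funext fun j => by rw [fderiv_toMap, hv, grProj_coe]⟩

theorem toMap_eq {F : κ → SHolFun p} {x : SVec p s} {y : SVec q s}
    (h : ∀ j, eval x (F j) = y j) : toMap q F s x = y :=
  funext fun j => by rw [toMap, h, grProj_coe]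

end SHolFun

theorem isSHol_of_eval {X Y : SSpace} {f : ∀ s, X.pts s → Y.pts s} (F : Y.ι → SHolFun X.par)
    (h : ∀ s x j, SHolFun.eval (X.coord x) (F j) = Y.coord (f s x) j) : IsSHol X Y f := by
  have h_coord (s : ℕ) (x : X.pts s) : Y.coord (f s x) = SHolFun.toMap Y.par F s (X.coord x) :=
    (SHolFun.toMap_eq (h s x)).symm
  have hF := SHolFun.sHolOn_toMap Y.par Set.univ F
  refine ⟨fun s t φ x => Y.coord_injective t ?_, fun s₀ x₀ =>
    ⟨Set.univ, isOpen_univ, trivial, _, hF, fun s x _ => h_coord s x⟩⟩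
  rw [Y.coord_map, h_coord, h_coord, X.coord_map]
  exact hF.natural s t φ _ trivial

theorem isSupermanifold_of_equations {X : SSpace} {m n k : ℕ} (q : Fin k → ZMod 2)
    (F : Fin k → SHolFun X.par)
    (h_mem : ∀ s (y : SVec X.par s) j, SHolFun.eval y (F j) ∈ gr s (q j))
    (h_zero : ∀ s (y : SVec X.par s),
      (∃ x : X.pts s, X.coord x = y) ↔ ∀ j, SHolFun.eval y (F j) = 0)
    (h_submersive : ∀ s (x : X.pts s) (w : SVec q s),
      ∃ v, ∀ j, SHolFun.tangent (X.coord x) v (F j) = w j)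
    (h_even : m + Nat.card {j // q j = 0} = Nat.card {i // X.par i = 0})
    (h_odd : n + Nat.card {j // q j = 1} = Nat.card {i // X.par i = 1}) :
    IsSupermanifold X m n := fun _ _ =>
  ⟨Set.univ, isOpen_univ, trivial, k, q, SHolFun.toMap q F, SHolFun.sHolOn_toMap q _ F,
    fun s y _ => by
      rw [h_zero, funext_iff]
      refine forall_congr' fun j => ?_
      rw [Subtype.ext_iff, SHolFun.toMap, coe_grProj_of_mem (h_mem s y j)]
      rfl,
    fun s x _ => SHolFun.surjective_fderiv_toMap (h_submersive s x), h_even, h_odd⟩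

end SuperholomorphicFunctions

/-! ### Composition of superholomorphic maps -/

section Composition

/-- The morphism of superpoints `ℝ^{0|t} → ℝ^{0|0} → ℝ^{0|s}` through the one reduced point. -/
def SPHom.throughPoint (s t : ℕ) : SPHom s t where
  hom := (Algebra.ofId ℝ (Gras t)).comp ExteriorAlgebra.algebraMapInv
  parity x := by
    have h : ((Algebra.ofId ℝ (Gras t)).comp ExteriorAlgebra.algebraMapInv).comp (grasInvol s) =
        (grasInvol t).comp ((Algebra.ofId ℝ (Gras t)).comp ExteriorAlgebra.algebraMapInv) := by
      refine ExteriorAlgebra.hom_ext (LinearMap.ext fun v => ?_)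
      have hv : grasInvol s (ExteriorAlgebra.ι ℝ v) = -ExteriorAlgebra.ι ℝ v :=
        CliffordAlgebra.involute_ι v
      simp [hv, ExteriorAlgebra.algebraMapInv]
    exact DFunLike.congr_fun h x

theorem SPHom.throughPoint_ob {s t : ℕ} (x : OB s) :
    (SPHom.throughPoint s t).ob x = algebraMap ℂ (OB t) (body s x) := by
  have h : (SPHom.throughPoint s t).ob = (Algebra.ofId ℂ (OB t)).comp (body s) := by
    refine OB.algHom_ext fun v => ?_
    have hv : ExteriorAlgebra.algebraMapInv (ExteriorAlgebra.ι ℝ v : Gras s) = 0 := by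
      simp [ExteriorAlgebra.algebraMapInv]
    rw [AlgHom.comp_apply, body_odd (gen_ι_mem_gr_one v), map_zero]
    change (1 : ℂ) ⊗ₜ[ℝ] (algebraMap ℝ (Gras t))
      (ExteriorAlgebra.algebraMapInv (ExteriorAlgebra.ι ℝ v : Gras s)) = 0
    rw [hv, map_zero, TensorProduct.tmul_zero]
  exact DFunLike.congr_fun h x

variable {ι κ μ : Type} {p : ι → ZMod 2} {q : κ → ZMod 2} {r : μ → ZMod 2} {s t : ℕ}

theorem SVec.red_map (φ : SPHom s t) (x : SVec p s) : (x.map φ).red = x.red :=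
  funext fun i => body_ob φ (x i)

theorem SVec.continuous_red : Continuous (SVec.red : SVec p s → ι → ℂ) :=
  continuous_pi fun i =>
    ((body s).toLinearMap.continuous_of_finiteDimensional.comp continuous_subtype_val).comp
      (continuous_apply i)

theorem isOpen_dom {U : Set (ι → ℂ)} (hU : IsOpen U) (s : ℕ) : IsOpen (dom p U s) :=
  hU.preimage SVec.continuous_red

/-- The `ℝ^{0|0}`-point with coordinates `u`; the odd coordinates of `u` are dropped. -/
def SVec.ofReduced (p : ι → ZMod 2) (u : ι → ℂ) : SVec p 0 := fun i => grProj 0 (p i) (u i • 1)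

theorem SVec.continuous_ofReduced : Continuous (SVec.ofReduced p) :=
  continuous_pi fun i => (grProj 0 (p i)).continuous.comp
    ((continuous_apply i).fun_smul continuous_const)

theorem SVec.map_throughPoint (x : SVec p s) :
    x.map (SPHom.throughPoint s 0) = SVec.ofReduced p x.red := funext fun i => by
  rw [SVec.ofReduced, ← grProj_coe (x.map (SPHom.throughPoint s 0) i), SVec.map_apply,
    SPHom.throughPoint_ob, Algebra.algebraMap_eq_smul_one]
  rfl

theorem SVec.ofReduced_mem_dom {U : Set (ι → ℂ)} {x : SVec p s} (hx : x ∈ dom p U s) :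
    SVec.ofReduced p x.red ∈ dom p U 0 := by
  rw [← SVec.map_throughPoint]
  change (x.map _).red ∈ U
  rw [SVec.red_map]
  exact hx

variable [Fintype ι] [Fintype κ] [Fintype μ]

theorem SHolOn.red_apply {U : Set (ι → ℂ)} {f : ∀ s, SVec p s → SVec q s} (hf : SHolOn U f)
    {x : SVec p s} (hx : x ∈ dom p U s) : (f 0 (SVec.ofReduced p x.red)).red = (f s x).red := by
  rw [← SVec.map_throughPoint, hf.natural _ _ _ _ hx, SVec.red_map]

theorem SHolOn.differentiableAt {U : Set (ι → ℂ)} {f : ∀ s, SVec p s → SVec q s}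
    (hf : SHolOn U f) (hU : IsOpen U) {x : SVec p s} (hx : x ∈ dom p U s) :
    DifferentiableAt ℂ (f s) x :=
  (hf.holo s).differentiableAt ((isOpen_dom hU s).mem_nhds hx)

theorem SHolOn.comp {U : Set (ι → ℂ)} {V : Set (κ → ℂ)} {W : Set (ι → ℂ)}
    {f : ∀ s, SVec p s → SVec q s} {g : ∀ s, SVec q s → SVec r s} (hg : SHolOn V g)
    (hf : SHolOn U f) (hU : IsOpen U) (hV : IsOpen V) (hWU : W ⊆ U)
    (hWV : ∀ s, Set.MapsTo (f s) (dom p W s) (dom q V s)) :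
    SHolOn W fun s x => g s (f s x) where
  natural s t φ x hx := by rw [hf.natural s t φ x (hWU hx), hg.natural s t φ _ (hWV s hx)]
  holo s := DifferentiableOn.fun_comp (𝕜 := ℂ) (E := SVec p s) (F := SVec q s) (G := SVec r s)
    (g := g s) (f := f s) (hg.holo s) ((hf.holo s).mono fun _ hx => hWU hx) (hWV s)
  evenLinear s x hx l v := by
    rw [fderiv_fun_comp (𝕜 := ℂ) (E := SVec p s) (F := SVec q s) (G := SVec r s) (g := g s)
      (f := f s) x (hg.differentiableAt hV (hWV s hx))
      (hf.differentiableAt hU (hWU hx)),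
      ContinuousLinearMap.comp_apply, ContinuousLinearMap.comp_apply,
      hf.evenLinear s x (hWU hx), hg.evenLinear s _ (hWV s hx)]

theorem SHolOn.exists_mapsTo {U : Set (ι → ℂ)} {V : Set (κ → ℂ)} {f : ∀ s, SVec p s → SVec q s}
    (hf : SHolOn U f) (hU : IsOpen U) (hV : IsOpen V) : ∃ W ⊆ U, IsOpen W ∧
      ∀ s, ∀ x ∈ dom p U s, x ∈ dom p W s ↔ f s x ∈ dom q V s := by
  refine ⟨U ∩ SVec.ofReduced p ⁻¹' (dom p U 0 ∩ f 0 ⁻¹' dom q V 0), Set.inter_subset_left,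
    hU.inter (((hf.holo 0).continuousOn.isOpen_inter_preimage (isOpen_dom hU 0)
      (isOpen_dom hV 0)).preimage SVec.continuous_ofReduced), fun s x hx => ?_⟩
  have h_red : f 0 (SVec.ofReduced p x.red) ∈ dom q V 0 ↔ f s x ∈ dom q V s := by
    simp only [dom, Set.mem_ofPred_eq, hf.red_apply hx]
  exact ⟨fun h => h_red.mp h.2.2, fun h => ⟨hx, SVec.ofReduced_mem_dom hx, h_red.mpr h⟩⟩

theorem IsSHol.comp {X Y Z : SSpace} {g : ∀ s, Y.pts s → Z.pts s} {f : ∀ s, X.pts s → Y.pts s}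
    (hg : IsSHol Y Z g) (hf : IsSHol X Y f) : IsSHol X Z fun s x => g s (f s x) := by
  refine ⟨fun s t φ x => by beta_reduce; rw [hf.1, hg.1], fun s₀ x₀ => ?_⟩
  obtain ⟨U, hU, hxU, F, hF, h_f⟩ := hf.2 s₀ x₀
  obtain ⟨V, hV, hyV, G, hG, h_g⟩ := hg.2 s₀ (f s₀ x₀)
  obtain ⟨W, hWU, hW, hWV⟩ := hF.exists_mapsTo hU hV
  have h_maps (s : ℕ) : Set.MapsTo (F s) (dom X.par W s) (dom Y.par V s) :=
    fun x hx => (hWV s x (hWU hx)).mp hx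
  refine ⟨W, hW, (hWV s₀ _ hxU).mpr ?_, fun s x => G s (F s x),
    hG.comp hF hU hV hWU h_maps, fun s x hx => ?_⟩
  · rw [← h_f s₀ x₀ hxU]
    exact hyV
  · have h_coord := h_f s x (hWU hx)
    rw [h_g s _ (h_coord ▸ h_maps s hx), h_coord]

end Composition

/-! ### The factorisation of `SC(ℙ^{1|1})` -/

section Factorisation

/-- The equations of `SC(ℙ^{1|1})` solved for `ad - bc`, `e`, `γ` and `δ`, for a matrix with
entries in any ring and rows `(a, c, γ)`, `(b, d, δ)` and `(α, β, e)`. -/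
structure SolvedEqs {R : Type*} [Ring R] (M : Matrix (Fin 3) (Fin 3) R) : Prop where
  det : M 0 0 * M 1 1 - M 1 0 * M 0 1 = 1 + M 2 0 * M 2 1
  corner : M 2 2 = 1 - M 2 0 * M 2 1
  top : M 0 2 = M 0 1 * M 2 0 - M 0 0 * M 2 1
  bottom : M 1 2 = M 1 1 * M 2 0 - M 1 0 * M 2 1

variable {s : ℕ}

theorem odd_mul_odd_mul_left {α β : OB s} (hα : α ∈ gr s 1) (hβ : β ∈ gr s 1) :
    α * β * α = 0 := by
  rw [odd_comm hα hβ, neg_mul, mul_assoc, odd_sq hα, mul_zero, neg_zero]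

theorem odd_mul_odd_mul_right {α β : OB s} (hβ : β ∈ gr s 1) : α * β * β = 0 := by
  rw [mul_assoc, odd_sq hβ, mul_zero]

theorem one_add_mul_one_sub {α β : OB s} (hα : α ∈ gr s 1) (hβ : β ∈ gr s 1) :
    (1 + α * β) * (1 - α * β) = 1 := by
  rw [mul_sub, add_mul _ _ (α * β), mul_one, one_mul, odd_mul_odd_sq hα hβ, add_zero,
    add_sub_cancel_right]

theorem eq_odd_combination_of_eq_mul {α β a c y : OB s} (hα : α ∈ gr s 1) (hβ : β ∈ gr s 1)
    (ha : a ∈ gr s 0) (hc : c ∈ gr s 0) (h : c * α - a * β = (1 - α * β) * y) :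
    y = c * α - a * β := by
  have h_kill : α * β * (c * α - a * β) = 0 := by
    rw [mul_sub, ← mul_assoc, ← mul_assoc, even_comm hc, even_comm ha, mul_assoc c, mul_assoc a,
      odd_mul_odd_mul_left hα hβ, odd_mul_odd_mul_right hβ, mul_zero, mul_zero, sub_zero]
  rw [← one_mul y, ← one_add_mul_one_sub hα hβ, mul_assoc, ← h, add_mul, one_mul, h_kill, add_zero]

namespace SC

theorem mat_mul (L N : SC s) : mat (L * N) = mat L * mat N := rfl

theorem mat_inv (L : SC s) : mat L⁻¹ = adj (mat L) := inv_eq_adj L.1 L.2.1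

theorem mat_toSC (l : SL2 s) : mat (toSC s l) = blockMat l.1 := rfl

theorem mat_susy (v : SVec oddPar s) : mat (susy s v) = susyMat (v 0 : OB s) (v 1) := rfl

theorem mat_corner (L : SC s) : mat L 2 2 = 1 - mat L 2 0 * mat L 2 1 :=
  congrArg Subtype.val <| eq_one_sub_of_sq_add_two_mul (e := ⟨mat L 2 2, e22 L.1.1⟩)
    (k := ⟨mat L 2 0 * mat L 2 1, gr_two (mul_mem_gr (o20 L.1.1) (o21 L.1.1))⟩)
    (Subtype.ext (odd_mul_odd_sq (o20 L.1.1) (o21 L.1.1))) (Subtype.ext L.2.1.h2) L.2.2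

theorem mat_det (L : SC s) :
    mat L 0 0 * mat L 1 1 - mat L 1 0 * mat L 0 1 = 1 + mat L 2 0 * mat L 2 1 := by
  -- the upper left entry of `L⁻¹ * L = 1`
  have h : adj (mat L) * mat L = 1 := by
    rw [← mat_inv, ← mat_mul, inv_mul_cancel]
    rfl
  have h00 : mat L 1 1 * mat L 0 0 - mat L 0 1 * mat L 1 0 + mat L 2 1 * mat L 2 0 = 1 := by
    simpa [adj, Matrix.mul_apply, Fin.sum_univ_three, sub_eq_add_neg] using
      congrFun (congrFun h 0) 0
  have h_ad : mat L 0 0 * mat L 1 1 = mat L 1 1 * mat L 0 0 := even_comm (e11 L.1.1) _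
  have h_bc : mat L 1 0 * mat L 0 1 = mat L 0 1 * mat L 1 0 := even_comm (e01 L.1.1) _
  have h_βα : mat L 2 1 * mat L 2 0 = -(mat L 2 0 * mat L 2 1) := odd_comm (o21 L.1.1) (o20 L.1.1)
  rw [h_ad, h_bc, ← h00, h_βα, neg_add_cancel_right]

theorem solvedEqs (L : SC s) : SolvedEqs (mat L) where
  det := mat_det L
  corner := mat_corner L
  top := eq_odd_combination_of_eq_mul (o20 L.1.1) (o21 L.1.1) (e00 L.1.1) (e01 L.1.1) <| by
    rw [← mat_corner L]
    exact L.2.1.h3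
  bottom := eq_odd_combination_of_eq_mul (o20 L.1.1) (o21 L.1.1) (e10 L.1.1) (e11 L.1.1) <| by
    rw [← mat_corner L]
    exact L.2.1.h4

end SC

/-- The odd entries `(α, β)` of the last row of an even supermatrix. -/
def oddPart (M : SMat s) : SVec oddPar s :=
  (![⟨M.1 2 0, o20 M⟩, ⟨M.1 2 1, o21 M⟩] : Fin 2 → gr s 1)

/-- The even element `½αβ`. -/
def halfMul (v : SVec oddPar s) : Even s :=
  ⟨(1 / 2 : ℂ) • ((v 0 : OB s) * v 1), (gr s 0).smul_mem _ (gr_two (mul_mem_gr (v 0).2 (v 1).2))⟩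

theorem halfMul_sq (v : SVec oddPar s) : halfMul v ^ 2 = 0 := Subtype.ext <| by
  change ((1 / 2 : ℂ) • ((v 0 : OB s) * v 1)) ^ 2 = 0
  rw [smul_pow, pow_two (_ * _), odd_mul_odd_sq (v 0).2 (v 1).2, smul_zero]

theorem coe_two_mul_halfMul (v : SVec oddPar s) :
    ((2 * halfMul v : Even s) : OB s) = v 0 * v 1 := by
  change 2 * (1 / 2 : ℂ) • ((v 0 : OB s) * v 1) = v 0 * v 1
  rw [two_mul, ← add_smul, add_halves, one_smul]

theorem halfMul_mul_apply (v : SVec oddPar s) (i : Fin 2) : (halfMul v : OB s) * v i = 0 := by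
  change (1 / 2 : ℂ) • ((v 0 : OB s) * v 1) * v i = 0
  rw [smul_mul_assoc, smul_eq_zero]
  right
  fin_cases i
  exacts [odd_mul_odd_mul_left (v 0).2 (v 1).2, odd_mul_odd_mul_right (v 1).2]

/-- The `SL_ℂ(2)`-component of an even supermatrix, its upper left block multiplied by
`1 - ½αβ = (1 + ½αβ)⁻¹`. -/
def slBlock (M : SMat s) : Matrix (Fin 2) (Fin 2) (Even s) :=
  (1 - halfMul (oddPart M)) •
    !![⟨M.1 0 0, e00 M⟩, ⟨M.1 0 1, e01 M⟩; ⟨M.1 1 0, e10 M⟩, ⟨M.1 1 1, e11 M⟩]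

theorem det_slBlock {M : SMat s} (h : SolvedEqs M.1) : (slBlock M).det = 1 := by
  have h_det : (⟨M.1 0 0, e00 M⟩ : Even s) * ⟨M.1 1 1, e11 M⟩ -
      ⟨M.1 1 0, e10 M⟩ * ⟨M.1 0 1, e01 M⟩ = 1 + 2 * halfMul (oddPart M) := Subtype.ext <| by
    rw [Subalgebra.coe_add, coe_two_mul_halfMul]
    exact h.det
  rw [slBlock, Matrix.det_smul, Matrix.det_fin_two_of, Fintype.card_fin,
    mul_comm (⟨M.1 0 1, e01 M⟩ : Even s), h_det]
  linear_combination (2 * halfMul (oddPart M) - 3) * halfMul_sq (oddPart M)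

theorem SolvedEqs.blockMat_mul_susyMat {M : SMat s} (h : SolvedEqs M.1) :
    blockMat (slBlock M) * susyMat (oddPart M 0 : OB s) (oddPart M 1) = M.1 := by
  have h_even (x : Even s) :
      ((1 - halfMul (oddPart M) : Even s) : OB s) * x * (1 + (halfMul (oddPart M) : OB s)) = x :=
    congrArg Subtype.val (show (1 - halfMul (oddPart M)) * x * (1 + halfMul (oddPart M)) = x by
      linear_combination -x * halfMul_sq (oddPart M))
  have h_odd (x : Even s) (i : Fin 2) :
      ((1 - halfMul (oddPart M) : Even s) : OB s) * x * oddPart M i = x * oddPart M i := by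
    rw [← even_comm (1 - halfMul (oddPart M)).2, mul_assoc, Subalgebra.coe_sub, sub_mul,
      halfMul_mul_apply, Subalgebra.coe_one, one_mul, sub_zero]
  ext i j
  rw [Matrix.mul_apply, Fin.sum_univ_three]
  fin_cases i <;> fin_cases j <;>
    simp only [blockMat, slBlock, susyMat, Matrix.of_apply, Matrix.cons_val', Matrix.cons_val_zero,
      Matrix.cons_val_one, Matrix.cons_val, Fin.zero_eta, Fin.mk_one, Fin.reduceFinMk, Fin.isValue,
      Matrix.smul_apply, smul_eq_mul, zero_mul, mul_zero, add_zero, zero_add, one_mul,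
      MulMemClass.coe_mul]
  · exact h_even ⟨_, e00 M⟩
  · exact h_even ⟨_, e01 M⟩
  · rw [mul_neg, neg_add_eq_sub, h_odd ⟨_, e01 M⟩ 0, h_odd ⟨_, e00 M⟩ 1, h.top]
    rfl
  · exact h_even ⟨_, e10 M⟩
  · exact h_even ⟨_, e11 M⟩
  · rw [mul_neg, neg_add_eq_sub, h_odd ⟨_, e11 M⟩ 0, h_odd ⟨_, e10 M⟩ 1, h.bottom]
    rfl
  · rfl
  · rfl
  · exact h.corner.symm

theorem toSC_injective : Function.Injective (toSC s) := fun l m h => by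
  have h_mat (i j : Fin 3) : blockMat l.1 i j = blockMat m.1 i j :=
    congrFun (congrFun (congrArg SC.mat h) i) j
  ext i j
  fin_cases i <;> fin_cases j
  exacts [h_mat 0 0, h_mat 0 1, h_mat 1 0, h_mat 1 1]

namespace SC

/-- The `SL_ℂ(2)`-component of a point of `SC(ℙ^{1|1})`. -/
def even (L : SC s) : SL2 s := ⟨slBlock L.1.1, det_slBlock (solvedEqs L)⟩

/-- The supersymmetry component of a point of `SC(ℙ^{1|1})`. -/
def odd (L : SC s) : SVec oddPar s := oddPart L.1.1

theorem toSC_even_mul_susy_odd (L : SC s) : toSC s (even L) * susy s (odd L) = L :=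
  mat_injective s (solvedEqs L).blockMat_mul_susyMat

theorem susy_zero : susy s 0 = 1 := by
  refine mat_injective s ((mat_susy 0).trans ?_)
  ext i j
  fin_cases i <;> fin_cases j <;> simp [susyMat, mat, ent]

theorem odd_toSC_mul_susy (l : SL2 s) (v : SVec oddPar s) : odd (toSC s l * susy s v) = v := by
  funext i
  refine Subtype.ext ?_
  fin_cases i
  · change (blockMat l.1 * susyMat (v 0 : OB s) (v 1)) 2 0 = v 0
    simp [blockMat, susyMat, Matrix.mul_apply, Fin.sum_univ_three]
  · change (blockMat l.1 * susyMat (v 0 : OB s) (v 1)) 2 1 = v 1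
    simp [blockMat, susyMat, Matrix.mul_apply, Fin.sum_univ_three]

theorem odd_susy (v : SVec oddPar s) : odd (susy s v) = v := by
  simpa only [map_one, one_mul] using odd_toSC_mul_susy 1 v

theorem odd_toSC_mul (l : SL2 s) (L : SC s) : odd (toSC s l * L) = odd L := by
  rw [← toSC_even_mul_susy_odd L, ← mul_assoc, ← map_mul, odd_toSC_mul_susy, odd_toSC_mul_susy]

theorem even_toSC_mul_susy (l : SL2 s) (v : SVec oddPar s) : even (toSC s l * susy s v) = l := by
  have h := toSC_even_mul_susy_odd (toSC s l * susy s v)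
  rw [odd_toSC_mul_susy] at h
  exact toSC_injective (mul_right_cancel h)

theorem even_toSC (l : SL2 s) : even (toSC s l) = l := by
  simpa only [susy_zero, mul_one] using even_toSC_mul_susy l 0

theorem odd_eq_iff (L N : SC s) : odd L = odd N ↔ ∃ l : SL2 s, toSC s l * L = N := by
  refine ⟨fun h => ⟨even N * (even L)⁻¹, ?_⟩, ?_⟩
  · calc toSC s (even N * (even L)⁻¹) * L
        = toSC s (even N * (even L)⁻¹) * (toSC s (even L) * susy s (odd L)) := by
          rw [toSC_even_mul_susy_odd L]
      _ = N := by rw [← mul_assoc, ← map_mul, inv_mul_cancel_right, h, toSC_even_mul_susy_odd]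
  · rintro ⟨l, rfl⟩
    rw [odd_toSC_mul]

end SC

theorem SolvedEqs.exists_point {M : SMat s} (h : SolvedEqs M.1) : ∃ L : SC s, SC.mat L = M.1 :=
  ⟨toSC s ⟨slBlock M, det_slBlock h⟩ * susy s (oddPart M), h.blockMat_mul_susyMat⟩

theorem existsUnique_toSC_mul_susy (L : SC s) :
    ∃! x : SL2 s × SVec oddPar s, toSC s x.1 * susy s x.2 = L := by
  refine ⟨(SC.even L, SC.odd L), SC.toSC_even_mul_susy_odd L, ?_⟩
  rintro ⟨l, v⟩ rfl
  exact Prod.ext (SC.even_toSC_mul_susy l v).symm (SC.odd_toSC_mul_susy l v).symm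

/-- The coset space as `ℂ^{0|2}`: a coset is determined by its supersymmetry component. -/
def cosetEquiv (s : ℕ) : Coset s ≃ SVec oddPar s where
  toFun := Quotient.lift SC.odd fun L N h => by
    obtain ⟨l, hl⟩ := QuotientGroup.rightRel_apply.mp h
    exact (SC.odd_eq_iff L N).mpr ⟨l, by rw [hl, inv_mul_cancel_right]⟩
  invFun v := cosetMk s (susy s v)
  left_inv := by
    rintro ⟨L⟩
    refine Quotient.sound (QuotientGroup.rightRel_apply.mpr ⟨SC.even L, ?_⟩)
    exact eq_mul_inv_of_mul_eq (SC.toSC_even_mul_susy_odd L)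
  right_inv v := SC.odd_susy v

end Factorisation

/-! ### Products, projections and constant maps -/

section Products

variable {ι κ μ : Type} {p : ι → ZMod 2} {q : κ → ZMod 2} {r : μ → ZMod 2} {s : ℕ}

/-- The identification of a pair of points of linear superspaces with a point of their product. -/
def SVec.pairCLM (q : κ → ZMod 2) (r : μ → ZMod 2) (s : ℕ) :
    SVec q s × SVec r s →L[ℂ] SVec (Sum.elim q r) s :=
  ContinuousLinearMap.pi fun i => match i with
    | Sum.inl k => ContinuousLinearMap.proj k ∘L ContinuousLinearMap.fst ℂ _ _
    | Sum.inr m => ContinuousLinearMap.proj m ∘L ContinuousLinearMap.snd ℂ _ _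

theorem SVec.pairCLM_map {t : ℕ} (φ : SPHom s t) (x : SVec q s) (y : SVec r s) :
    pairCLM q r t (x.map φ, y.map φ) = (pairCLM q r s (x, y)).map φ := by
  funext i
  rcases i with k | m <;> rfl

theorem SVec.pairCLM_evenSMul (l : Even s) (x : SVec q s) (y : SVec r s) :
    pairCLM q r s (x.evenSMul l, y.evenSMul l) = (pairCLM q r s (x, y)).evenSMul l := by
  funext i
  rcases i with k | m <;> rfl

theorem coord_prodSpace {X Y : SSpace} (x : X.pts s) (y : Y.pts s) :
    (prodSpace X Y).coord (s := s) (x, y) =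
      SVec.pairCLM X.par Y.par s (X.coord x, Y.coord y) := by
  funext i
  rcases i with k | m <;> rfl

theorem SHolOn.prodMk [Fintype ι] [Fintype κ] [Fintype μ] {U V : Set (ι → ℂ)}
    {f : ∀ s, SVec p s → SVec q s} {g : ∀ s, SVec p s → SVec r s} (hf : SHolOn U f)
    (hg : SHolOn V g) (hU : IsOpen U) (hV : IsOpen V) :
    SHolOn (U ∩ V) fun s x => SVec.pairCLM q r s (f s x, g s x) := by
  have h_deriv (s : ℕ) (x : SVec p s) (hx : x ∈ dom p (U ∩ V) s) :
      HasFDerivAt (fun y => SVec.pairCLM q r s (f s y, g s y))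
        (SVec.pairCLM q r s ∘L (fderiv ℂ (f s) x).prod (fderiv ℂ (g s) x)) x :=
    HasFDerivAt.comp (𝕜 := ℂ) (E := SVec p s) (F := SVec q s × SVec r s)
      (G := SVec (Sum.elim q r) s) x (SVec.pairCLM q r s).hasFDerivAt
      (HasFDerivAt.prodMk (𝕜 := ℂ) (E := SVec p s) (F := SVec q s) (G := SVec r s)
        (hf.differentiableAt hU hx.1).hasFDerivAt (hg.differentiableAt hV hx.2).hasFDerivAt)
  refine ⟨fun s t φ x hx => ?_, fun s x hx =>
    (h_deriv s x hx).differentiableAt.differentiableWithinAt, fun s x hx l v => ?_⟩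
  · rw [hf.natural s t φ x hx.1, hg.natural s t φ x hx.2, SVec.pairCLM_map]
  · rw [(h_deriv s x hx).fderiv, ContinuousLinearMap.comp_apply, ContinuousLinearMap.prod_apply,
      hf.evenLinear s x hx.1, hg.evenLinear s x hx.2, SVec.pairCLM_evenSMul]
    rfl

variable {X Y Z : SSpace}

theorem IsSHol.prodMk {f : ∀ s, X.pts s → Y.pts s} {g : ∀ s, X.pts s → Z.pts s}
    (hf : IsSHol X Y f) (hg : IsSHol X Z g) :
    IsSHol X (prodSpace Y Z) fun s x => (f s x, g s x) := by
  refine ⟨fun s t φ x => Prod.ext (hf.1 s t φ x) (hg.1 s t φ x), fun s₀ x₀ => ?_⟩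
  obtain ⟨U, hU, hxU, F, hF, h_f⟩ := hf.2 s₀ x₀
  obtain ⟨V, hV, hxV, G, hG, h_g⟩ := hg.2 s₀ x₀
  refine ⟨U ∩ V, hU.inter hV, ⟨hxU, hxV⟩, _, hF.prodMk hG hU hV, fun s x hx => ?_⟩
  rw [coord_prodSpace, h_f s x hx.1, h_g s x hx.2]

theorem isSHol_fst : IsSHol (prodSpace X Y) X fun _ x => x.1 :=
  isSHol_of_eval (fun i => SHolFun.coord _ (Sum.inl i)) fun _ _ _ => rfl

theorem isSHol_snd : IsSHol (prodSpace X Y) Y fun _ x => x.2 :=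
  isSHol_of_eval (fun i => SHolFun.coord _ (Sum.inr i)) fun _ _ _ => rfl

theorem isSHol_const (y : Y.pts 0) : IsSHol X Y fun s _ => Y.map (SPHom.throughPoint 0 s) y :=
  isSHol_of_eval (fun j => algebraMap ℂ _ (body 0 (Y.coord y j))) fun s x j => by
    rw [AlgHom.commutes, Y.coord_map, SVec.map_apply, SPHom.throughPoint_ob]

theorem map_throughPoint_zero (x : X.pts 0) : X.map (SPHom.throughPoint 0 0) x = x := by
  have h : (SPHom.throughPoint 0 0).ob = AlgHom.id ℂ (OB 0) := OB.algHom_ext fun v => by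
    have hv : (gen (ExteriorAlgebra.ι ℝ v) : OB 0) = 0 := by
      rw [Subsingleton.elim v 0, map_zero]
      exact TensorProduct.tmul_zero _ _
    rw [hv, map_zero, map_zero]
  refine X.coord_injective 0 (funext fun i => Subtype.ext ?_)
  rw [X.coord_map, SVec.map_apply, h, AlgHom.id_apply]

theorem isSEmbedding_of_leftInverse {f : ∀ s, X.pts s → Y.pts s} {g : ∀ s, Y.pts s → X.pts s}
    (hf : IsSHol X Y f) (hg : IsSHol Y X g) (h : ∀ s, Function.LeftInverse (g s) (f s)) :
    IsSEmbedding X Y f := by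
  refine ⟨hf, fun s => (h s).injective, fun s₀ x₀ => ?_⟩
  obtain ⟨U, hU, hxU, G, hG, h_coord⟩ := hg.2 s₀ (f s₀ x₀)
  exact ⟨U, hU, hxU, G, hG, fun s x hx => by rw [← h_coord s _ hx, h s x]⟩

end Products

/-! ### The structure maps of the groups and of the factorisation -/

section StructureMaps

theorem isSHol_SL2Space_of_eval {X : SSpace} {f : ∀ s, X.pts s → SL2 s}
    (M : Matrix (Fin 2) (Fin 2) (SHolFun X.par))
    (h : ∀ s x, (SHolFun.eval (X.coord x)).mapMatrix M = (Even s).val.mapMatrix (f s x).1) :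
    IsSHol X SL2Space f :=
  isSHol_of_eval (Y := SL2Space) (fun ij => M ij.1 ij.2) fun s x ij =>
    congrFun (congrFun (h s x) ij.1) ij.2

theorem isSHol_SCSpace_of_eval {X : SSpace} {f : ∀ s, X.pts s → SC s}
    (M : Matrix (Fin 3) (Fin 3) (SHolFun X.par))
    (h : ∀ s x, (SHolFun.eval (X.coord x)).mapMatrix M = SC.mat (f s x)) :
    IsSHol X SCSpace f :=
  isSHol_of_eval (Y := SCSpace) (fun ij => M ij.1 ij.2) fun s x ij =>
    congrFun (congrFun (h s x) ij.1) ij.2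

theorem isSHol_SL2_mul : IsSHol (prodSpace SL2Space SL2Space) SL2Space fun _ x => x.1 * x.2 := by
  let x (i j : Fin 2) : SHolFun (prodSpace SL2Space SL2Space).par :=
    SHolFun.coord _ (Sum.inl (i, j))
  let y (i j : Fin 2) : SHolFun (prodSpace SL2Space SL2Space).par :=
    SHolFun.coord _ (Sum.inr (i, j))
  exact isSHol_SL2Space_of_eval (Matrix.of x * Matrix.of y) fun s z =>
    (map_mul (SHolFun.eval _).mapMatrix _ _).trans (map_mul (Even s).val.mapMatrix z.1.1 z.2.1).symm

theorem isSHol_SC_mul :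
    IsSHol (prodSpace SCSpace SCSpace) SCSpace fun s x => (x.1 * x.2 : SC s) := by
  let x (i j : Fin 3) : SHolFun (prodSpace SCSpace SCSpace).par :=
    SHolFun.coord _ (Sum.inl (i, j))
  let y (i j : Fin 3) : SHolFun (prodSpace SCSpace SCSpace).par :=
    SHolFun.coord _ (Sum.inr (i, j))
  exact isSHol_SCSpace_of_eval (Matrix.of x * Matrix.of y) fun _ _ =>
    map_mul (SHolFun.eval _).mapMatrix _ _

theorem isSHol_SL2_inv : IsSHol SL2Space SL2Space fun _ l => l⁻¹ := by
  let x (i j : Fin 2) : SHolFun SL2Space.par := SHolFun.coord _ (i, j)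
  refine isSHol_SL2Space_of_eval !![x 1 1, -x 0 1; -x 1 0, x 0 0] fun s (l : SL2 s) => ?_
  refine Eq.trans ?_ (congrArg (Even s).val.mapMatrix l.1.adjugate_fin_two).symm
  ext i j
  fin_cases i <;> fin_cases j <;> rfl

theorem isSHol_SC_inv : IsSHol SCSpace SCSpace fun _ L => L⁻¹ := by
  let x (i j : Fin 3) : SHolFun SCSpace.par := SHolFun.coord _ (i, j)
  refine isSHol_SCSpace_of_eval
    !![x 1 1, -x 0 1, x 2 1; -x 1 0, x 0 0, -x 2 0; -x 1 2, x 0 2, x 2 2] fun s (L : SC s) =>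
    Eq.trans ?_ (SC.mat_inv L).symm
  ext i j
  fin_cases i <;> fin_cases j <;> rfl

theorem isSHol_toSC : IsSHol SL2Space SCSpace fun s l => toSC s l := by
  let x (i j : Fin 2) : SHolFun SL2Space.par := SHolFun.coord _ (i, j)
  refine isSHol_SCSpace_of_eval !![x 0 0, x 0 1, 0; x 1 0, x 1 1, 0; 0, 0, 1] fun s l =>
    Eq.trans ?_ (SC.mat_toSC l).symm
  ext i j
  fin_cases i <;> fin_cases j <;> rfl

theorem isSHol_susy : IsSHol C02 SCSpace susy := by
  let α : SHolFun C02.par := SHolFun.coord oddPar 0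
  let β : SHolFun C02.par := SHolFun.coord oddPar 1
  refine isSHol_SCSpace_of_eval !![1 + (1 / 2 : ℂ) • (α * β), 0, -β;
    0, 1 + (1 / 2 : ℂ) • (α * β), α; α, β, 1 - α * β] fun s v =>
    Eq.trans ?_ (SC.mat_susy v).symm
  ext i j
  fin_cases i <;> fin_cases j <;> rfl

theorem isSHol_odd : IsSHol SCSpace C02 fun _ L => SC.odd L :=
  isSHol_of_eval (Y := C02) ![SHolFun.coord _ (2, 0), SHolFun.coord _ (2, 1)] fun _ _ j => by
    fin_cases j <;> rfl

theorem isSHol_even : IsSHol SCSpace SL2Space fun _ L => SC.even L := by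
  let x (i j : Fin 3) : SHolFun SCSpace.par := SHolFun.coord _ (i, j)
  refine isSHol_SL2Space_of_eval
    ((1 - (1 / 2 : ℂ) • (x 2 0 * x 2 1)) • !![x 0 0, x 0 1; x 1 0, x 1 1]) fun s L => ?_
  ext i j
  fin_cases i <;> fin_cases j <;> rfl

theorem isSHol_toSC_mul_susy : IsSHol (prodSpace SL2Space C02) SCSpace
    fun s x => (toSC s x.1 * susy s x.2 : SC s) := by
  have h_toSC : IsSHol (prodSpace SL2Space C02) SCSpace fun s x => toSC s x.1 :=
    isSHol_toSC.comp isSHol_fst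
  have h_susy : IsSHol (prodSpace SL2Space C02) SCSpace fun s x => susy s x.2 :=
    isSHol_susy.comp isSHol_snd
  have h_mul := isSHol_SC_mul.comp (h_toSC.prodMk h_susy)
  exact h_mul

theorem isSIso_toSC_mul_susy : IsSIso (prodSpace SL2Space C02) SCSpace
    fun s x => (toSC s x.1 * susy s x.2 : SC s) :=
  ⟨isSHol_toSC_mul_susy, fun _ L => ((SC.even L, SC.odd L) : SL2 _ × SVec oddPar _),
    isSHol_even.prodMk isSHol_odd,
    fun s (x : SL2 s × SVec oddPar s) =>
      Prod.ext (SC.even_toSC_mul_susy x.1 x.2) (SC.odd_toSC_mul_susy x.1 x.2),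
    fun _ L => SC.toSC_even_mul_susy_odd L⟩


theorem isSEmbedding_toSC : IsSEmbedding SL2Space SCSpace fun s l => toSC s l :=
  isSEmbedding_of_leftInverse isSHol_toSC isSHol_even fun _ => SC.even_toSC

end StructureMaps

/-! ### The space of cosets as a quotient -/

section Quotients

theorem isSQuotient_of_sections {G X Q : SSpace} [Nonempty (X.pts 0)]
    {act : ∀ s, G.pts s → X.pts s → X.pts s} {π : ∀ s, X.pts s → Q.pts s} (hπ : IsSHol X Q π)
    (h_orbits : ∀ s (x y : X.pts s), π s x = π s y ↔ ∃ g : G.pts s, act s g x = y)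
    (h_section : ∀ x₀ : X.pts 0, ∃ σ : ∀ s, Q.pts s → X.pts s, IsSHol Q X σ ∧
      (∀ s, Function.RightInverse (σ s) (π s)) ∧ σ 0 (π 0 x₀) = x₀) :
    IsSQuotient G X Q act π where
  shol := hπ
  surjective s := by
    obtain ⟨σ, -, h_right, -⟩ := h_section (Classical.arbitrary _)
    exact (h_right s).surjective
  orbits := h_orbits
  submersion x₀ := by
    obtain ⟨σ, hσ, h_right, h_through⟩ := h_section x₀
    obtain ⟨U, hU, hxU, S, hS, h_coord⟩ := hσ.2 0 (π 0 x₀)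
    refine ⟨U, hU, hxU, S, hS, ?_, fun s y hy => ⟨σ s y, h_coord s y hy, h_right s y⟩⟩
    rw [← h_coord 0 _ hxU, h_through]
  universal Y h hh h_inv := by
    obtain ⟨σ, hσ, h_right, -⟩ := h_section (Classical.arbitrary _)
    refine ⟨fun s y => h s (σ s y), ⟨hh.comp hσ, fun s x => ?_⟩, fun h' ⟨_, h_factor⟩ => ?_⟩
    · obtain ⟨g, hg⟩ := (h_orbits s _ x).mp (h_right s (π s x))
      beta_reduce
      rw [← h_inv s g, hg]
    · funext s y
      rw [← h_factor s (σ s y), h_right s y]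

theorem isSQuotient_odd : IsSQuotient SL2Space SCSpace C02 leftAct fun _ L => SC.odd L := by
  have : Nonempty (SCSpace.pts 0) := ⟨(1 : SC 0)⟩
  refine isSQuotient_of_sections isSHol_odd (fun s => SC.odd_eq_iff) fun (L : SC 0) => ?_
  have h_const : IsSHol C02 SL2Space fun s _ => SL2Space.map (SPHom.throughPoint 0 s) (SC.even L) :=
    isSHol_const (Y := SL2Space) (SC.even L)
  have h_translate := isSHol_SC_mul.comp ((isSHol_toSC.comp h_const).prodMk isSHol_susy)
  refine ⟨_, h_translate, fun s v => SC.odd_toSC_mul_susy _ v, ?_⟩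
  refine Eq.trans ?_ (SC.toSC_even_mul_susy_odd L)
  exact congrArg (fun l : SL2 0 => toSC 0 l * susy 0 (SC.odd L))
    (map_throughPoint_zero (X := SL2Space) (SC.even L))

end Quotients

/-! ### The two groups as complex super Lie groups -/

section SuperLieGroups

variable {s : ℕ}

theorem mul_sub_mul_euler {R : Type*} [Ring R] {t : R} (ht : ∀ x, x * t = t * x) (a b c d : R) :
    a * (t * d) + t * a * d - (b * (t * c) + t * b * c) = (a * d - b * c) * (t + t) := by
  rw [mul_add, ht, ← mul_assoc a, ← mul_assoc b, ht a, ht b, mul_assoc, mul_assoc, mul_sub]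
  abel

/-- The function `ad - bc - 1` on `ℂ^{4|0}`. -/
def detSubOne : SHolFun fun _ : Fin 2 × Fin 2 => 0 :=
  SHolFun.coord _ (0, 0) * SHolFun.coord _ (1, 1) -
    SHolFun.coord _ (0, 1) * SHolFun.coord _ (1, 0) - 1

theorem tangent_detSubOne_evenSMul (t : Even s) (y : SVec (fun _ : Fin 2 × Fin 2 => 0) s) :
    SHolFun.tangent y (SVec.evenSMul t y) detSubOne =
      (SHolFun.eval y detSubOne + 1) * ((t : OB s) + t) := by
  have h_euler := mul_sub_mul_euler (even_comm t.2) (y (0, 0) : OB s) (y (0, 1)) (y (1, 0))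
    (y (1, 1))
  simpa [detSubOne, SVec.evenSMul_apply] using h_euler

theorem exists_SL2Space_coord_eq_iff (y : SVec SL2Space.par s) :
    (∃ l, SL2Space.coord l = y) ↔ SHolFun.eval y detSubOne = 0 := by
  let M : Matrix (Fin 2) (Fin 2) (Even s) := Matrix.of fun i j => y (i, j)
  have h_det : M.det = 1 ↔ SHolFun.eval y detSubOne = 0 := by
    rw [Matrix.det_fin_two, ← sub_eq_zero, Subtype.ext_iff]
    rfl
  refine Iff.trans ⟨?_, fun h => ⟨⟨M, h⟩, rfl⟩⟩ h_det
  rintro ⟨l, rfl⟩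
  exact l.2

theorem isSupermanifold_SL2 : IsSupermanifold SL2Space 3 0 := by
  refine isSupermanifold_of_equations (k := 1) (fun _ => 0) (fun _ => detSubOne) (fun s y _ => ?_)
    (fun s y => ?_) (fun s l w => ?_) ?_ ?_
  · exact sub_mem (sub_mem ((Even s).mul_mem (y (0, 0)).2 (y (1, 1)).2)
      ((Even s).mul_mem (y (0, 1)).2 (y (1, 0)).2)) (one_mem_gr s)
  · exact (exists_SL2Space_coord_eq_iff y).trans (forall_const _).symm
  · let t : Even s := ⟨(1 / 2 : ℂ) • (w 0 : OB s), (gr s 0).smul_mem _ (w 0).2⟩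
    have h_double : (t : OB s) + t = w 0 := by rw [← add_smul, add_halves, one_smul]
    have h_eval : SHolFun.eval (SL2Space.coord l) detSubOne = 0 :=
      (exists_SL2Space_coord_eq_iff _).mp ⟨l, rfl⟩
    refine ⟨SVec.evenSMul t (SL2Space.coord l), fun j => ?_⟩
    obtain rfl := Subsingleton.elim j 0
    refine (tangent_detSubOne_evenSMul t (SL2Space.coord l)).trans ?_
    exact (congrArg₂ (fun d u : OB s => (d + 1) * u) h_eval h_double).trans (by simp)
  · change 3 + Nat.card {_j : Fin 1 // (0 : ZMod 2) = 0} =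
      Nat.card {_i : Fin 2 × Fin 2 // (0 : ZMod 2) = 0}
    rw [Nat.card_eq_fintype_card, Nat.card_eq_fintype_card]
    rfl
  · change 0 + Nat.card {_j : Fin 1 // (0 : ZMod 2) = 1} =
      Nat.card {_i : Fin 2 × Fin 2 // (0 : ZMod 2) = 1}
    rw [Nat.card_eq_fintype_card, Nat.card_eq_fintype_card]
    rfl

theorem isSuperLieGroup_SL2 : IsSuperLieGroup SL2Space 3 0 :=
  ⟨isSupermanifold_SL2, isSHol_SL2_mul, isSHol_SL2_inv⟩

/-- The differences of the two sides of the equations `SolvedEqs`. -/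
def SolvedEqs.defect {R : Type*} [Ring R] (M : Matrix (Fin 3) (Fin 3) R) : Fin 4 → R :=
  ![M 0 0 * M 1 1 - M 1 0 * M 0 1 - (1 + M 2 0 * M 2 1),
    M 2 2 - (1 - M 2 0 * M 2 1),
    M 0 2 - (M 0 1 * M 2 0 - M 0 0 * M 2 1),
    M 1 2 - (M 1 1 * M 2 0 - M 1 0 * M 2 1)]

theorem SolvedEqs.defect_eq_zero_iff {R : Type*} [Ring R] {M : Matrix (Fin 3) (Fin 3) R} :
    (∀ j, defect M j = 0) ↔ SolvedEqs M :=
  ⟨fun h => ⟨sub_eq_zero.mp (h 0), sub_eq_zero.mp (h 1), sub_eq_zero.mp (h 2),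
    sub_eq_zero.mp (h 3)⟩, fun h j => by
    fin_cases j
    exacts [sub_eq_zero.mpr h.det, sub_eq_zero.mpr h.corner, sub_eq_zero.mpr h.top,
      sub_eq_zero.mpr h.bottom]⟩

/-- The parities of the equations `SolvedEqs`. -/
def SolvedEqs.par : Fin 4 → ZMod 2 := ![0, 0, 1, 1]

theorem SolvedEqs.defect_mem_gr (M : SMat s) (j : Fin 4) : defect M.1 j ∈ gr s (par j) := by
  have h_even {x y : OB s} (hx : x ∈ gr s 0) (hy : y ∈ gr s 0) : x * y ∈ gr s 0 :=
    (Even s).mul_mem hx hy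
  have h_odd {x y : OB s} (hx : x ∈ gr s 0) (hy : y ∈ gr s 1) : x * y ∈ gr s 1 := by
    simpa only [zero_add] using mul_mem_gr hx hy
  have h_αβ := gr_two (mul_mem_gr (o20 M) (o21 M))
  fin_cases j
  · exact sub_mem (sub_mem (h_even (e00 M) (e11 M)) (h_even (e10 M) (e01 M)))
      (add_mem (one_mem_gr s) h_αβ)
  · exact sub_mem (e22 M) (sub_mem (one_mem_gr s) h_αβ)
  · exact sub_mem (o02 M) (sub_mem (h_odd (e01 M) (o20 M)) (h_odd (e00 M) (o21 M)))
  · exact sub_mem (o12 M) (sub_mem (h_odd (e11 M) (o20 M)) (h_odd (e10 M) (o21 M)))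

theorem SolvedEqs.defect_map {R S : Type*} [Ring R] [Ring S] (φ : R →+* S)
    (M : Matrix (Fin 3) (Fin 3) R) (j : Fin 4) : defect (φ.mapMatrix M) j = φ (defect M j) := by
  fin_cases j <;> simp [defect]

/-- The derivative of `SolvedEqs.defect` at `M` in the direction `N`. -/
def SolvedEqs.defectDeriv {R : Type*} [Ring R] (M N : Matrix (Fin 3) (Fin 3) R) : Fin 4 → R :=
  let αβ' := M 2 0 * N 2 1 + N 2 0 * M 2 1
  ![M 0 0 * N 1 1 + N 0 0 * M 1 1 - (M 1 0 * N 0 1 + N 1 0 * M 0 1) - αβ',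
    N 2 2 + αβ',
    N 0 2 - (M 0 1 * N 2 0 + N 0 1 * M 2 0 - (M 0 0 * N 2 1 + N 0 0 * M 2 1)),
    N 1 2 - (M 1 1 * N 2 0 + N 1 1 * M 2 0 - (M 1 0 * N 2 1 + N 1 0 * M 2 1))]

/-- A direction in which `SolvedEqs.defect` has the prescribed derivative `w` when `t` is central
and `(1 + αβ) 2t = w 0`: the first two rows are scaled by `t`, which leaves the equations for `γ`
and `δ` intact, and then the entries `γ`, `δ` and `e`, for which the equations are solved, are
adjusted. -/
def SolvedEqs.lift {R : Type*} [Ring R] (M : Matrix (Fin 3) (Fin 3) R) (t : R) (w : Fin 4 → R) :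
    Matrix (Fin 3) (Fin 3) R :=
  !![t * M 0 0, t * M 0 1, t * M 0 2 + w 2; t * M 1 0, t * M 1 1, t * M 1 2 + w 3; 0, 0, w 1]

theorem SolvedEqs.defectDeriv_lift {R : Type*} [Ring R] {M : Matrix (Fin 3) (Fin 3) R}
    (h : SolvedEqs M) {t : R} (ht : ∀ x, x * t = t * x) {w : Fin 4 → R}
    (htw : (1 + M 2 0 * M 2 1) * (t + t) = w 0) : defectDeriv M (lift M t w) = w := by
  have h_euler := mul_sub_mul_euler ht (M 0 0) (M 1 0) (M 0 1) (M 1 1)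
  rw [h.det, htw] at h_euler
  funext j
  fin_cases j
  · simpa [defectDeriv, lift] using h_euler
  · simp [defectDeriv, lift]
  · simp [defectDeriv, lift, h.top, mul_sub, mul_assoc]
  · simp [defectDeriv, lift, h.bottom, mul_sub, mul_assoc]

theorem SolvedEqs.lift_mem (M : SMat s) {t : OB s} (ht : t ∈ gr s 0) (w : SVec par s) :
    lift M.1 t (fun j => w j) ∈ SMat s := by
  have h_smul (i j : Fin 3) : t * M.1 i j ∈ gr s (par3 i + par3 j) := by
    simpa only [zero_add] using mul_mem_gr ht (M.2 i j)
  intro i j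
  fin_cases i <;> fin_cases j
  exacts [h_smul 0 0, h_smul 0 1, add_mem (h_smul 0 2) (w 2).2, h_smul 1 0, h_smul 1 1,
    add_mem (h_smul 1 2) (w 3).2, zero_mem _, zero_mem _, (w 1).2]

/-- The entries of an even supermatrix as a point of `ℂ^{5|4}`. -/
def matVec (M : SMat s) : SVec matPar s := fun ij => ⟨M.1 ij.1 ij.2, M.2 ij.1 ij.2⟩

/-- The matrix whose entries are the coordinate functions on `ℂ^{5|4}`. -/
def matCoord : Matrix (Fin 3) (Fin 3) (SHolFun matPar) :=
  Matrix.of fun i j => SHolFun.coord _ (i, j)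

theorem eval_defect_matCoord (M : SMat s) (j : Fin 4) :
    SHolFun.eval (matVec M) (SolvedEqs.defect matCoord j) = SolvedEqs.defect M.1 j :=
  (SolvedEqs.defect_map (SHolFun.eval (matVec M) : SHolFun matPar →+* OB s) matCoord j).symm

theorem tangent_defect_matCoord (M N : SMat s) (j : Fin 4) :
    SHolFun.tangent (matVec M) (matVec N) (SolvedEqs.defect matCoord j) =
      SolvedEqs.defectDeriv M.1 N.1 j := by
  fin_cases j <;> simp [SolvedEqs.defect, SolvedEqs.defectDeriv, matCoord, matVec, sub_eq_add_neg]

theorem exists_tangent_defect_eq {M : SMat s} (h : SolvedEqs M.1) (w : SVec SolvedEqs.par s) :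
    ∃ N : SMat s, ∀ j, SolvedEqs.defectDeriv M.1 N.1 j = w j := by
  have h_αβ := gr_two (mul_mem_gr (o20 M) (o21 M))
  let t : OB s := (1 / 2 : ℂ) • ((1 - M.1 2 0 * M.1 2 1) * w 0)
  have ht : t ∈ gr s 0 :=
    (gr s 0).smul_mem _ ((Even s).mul_mem (sub_mem (one_mem_gr s) h_αβ) (w 0).2)
  have h_double : t + t = (1 - M.1 2 0 * M.1 2 1) * w 0 := by
    rw [← add_smul, add_halves, one_smul]
  have htw : (1 + M.1 2 0 * M.1 2 1) * (t + t) = w 0 := by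
    rw [h_double, ← mul_assoc]
    exact (congrArg (· * (w 0 : OB s)) (one_add_mul_one_sub (o20 M) (o21 M))).trans (one_mul _)
  have h_deriv := h.defectDeriv_lift (w := fun j => (w j : OB s)) (even_comm ht) htw
  exact ⟨⟨_, SolvedEqs.lift_mem M ht w⟩, fun j => congrFun h_deriv j⟩

theorem isSupermanifold_SC : IsSupermanifold SCSpace 3 2 := by
  refine isSupermanifold_of_equations SolvedEqs.par (SolvedEqs.defect matCoord)
    (fun s y j => ?_) (fun s y => ?_) (fun s (L : SC s) w => ?_) ?_ ?_
  · let M : SMat s := ⟨fun i j => y (i, j), fun i j => (y (i, j)).2⟩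
    have h := eval_defect_matCoord M j ▸ SolvedEqs.defect_mem_gr M j
    exact h
  · let M : SMat s := ⟨fun i j => y (i, j), fun i j => (y (i, j)).2⟩
    have h_point : (∃ L : SC s, SCSpace.coord L = y) ↔ SolvedEqs M.1 := by
      refine ⟨?_, fun h => ?_⟩
      · rintro ⟨L, rfl⟩
        exact SC.solvedEqs L
      · obtain ⟨L, hL⟩ := h.exists_point
        exact ⟨L, funext fun ij => Subtype.ext (congrFun (congrFun hL ij.1) ij.2)⟩
    refine h_point.trans (SolvedEqs.defect_eq_zero_iff.symm.trans (forall_congr' fun j => ?_))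
    rw [← eval_defect_matCoord]
    rfl
  · obtain ⟨N, hN⟩ := exists_tangent_defect_eq (SC.solvedEqs L) w
    exact ⟨matVec N, fun j => (tangent_defect_matCoord L.1.1 N j).trans (hN j)⟩
  · change 3 + Nat.card {j // SolvedEqs.par j = 0} = Nat.card {ij // matPar ij = 0}
    rw [Nat.card_eq_fintype_card, Nat.card_eq_fintype_card]
    rfl
  · change 2 + Nat.card {j // SolvedEqs.par j = 1} = Nat.card {ij // matPar ij = 1}
    rw [Nat.card_eq_fintype_card, Nat.card_eq_fintype_card]
    rfl

theorem isSuperLieGroup_SC : IsSuperLieGroup SCSpace 3 2 :=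
  ⟨isSupermanifold_SC, isSHol_SC_mul, isSHol_SC_inv⟩

end SuperLieGroups

end SG

end

theorem mainTheorem6 :
    -- both groups are complex super Lie groups
    SG.IsSuperLieGroup SG.SL2Space 3 0 ∧
    SG.IsSuperLieGroup SG.SCSpace 3 2 ∧
    -- the group homomorphism `l ↦ diag(l, 1)` is an embedding
    SG.IsSEmbedding SG.SL2Space SG.SCSpace (fun s l => SG.toSC s l) ∧
    -- the coset space is isomorphic to `ℂ^{0|2}`, via the supersymmetry matrices
    (∃ Ψ : ∀ s : ℕ, SG.Coset s ≃ SG.SVec SG.oddPar s,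
      SG.IsSQuotient SG.SL2Space SG.SCSpace SG.C02 SG.leftAct
        (fun s L => Ψ s (SG.cosetMk s L)) ∧
      ∀ (s : ℕ) (v : SG.SVec SG.oddPar s), Ψ s (SG.cosetMk s (SG.susy s v)) = v) ∧
    -- the product map is an isomorphism of complex supermanifolds
    SG.IsSIso (SG.prodSpace SG.SL2Space SG.C02) SG.SCSpace
      (fun s x => (SG.toSC s x.1 * SG.susy s x.2 : SG.SC s)) ∧
    -- every point factors uniquely
    ∀ (s : ℕ) (L : SG.SC s), ∃! x : SG.SL2 s × SG.SVec SG.oddPar s,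
      SG.toSC s x.1 * SG.susy s x.2 = L := by
  exact ⟨SG.isSuperLieGroup_SL2, SG.isSuperLieGroup_SC, SG.isSEmbedding_toSC,
    ⟨SG.cosetEquiv, SG.isSQuotient_odd, fun _ v => SG.SC.odd_susy v⟩,
    SG.isSIso_toSC_mul_susy, fun _ L => SG.existsUnique_toSC_mul_susy L⟩
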